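/- Consider the following key-value storage scheme for $n$ keys from a finite universe $U$, with parameters $t$ (a constant with $t>81e$) and $C\ge 1$ (which may depend on $n$). *Buckets.* Let $2^h$ be the least power of two that is at least $\lceil\log_2 n\rceil$. The server stores $\lceil n/2^h\rceil$ complete binary trees with $2^h$ leaves each; every node has $t$ slots for one block each. Let $b=2^h\lceil n/2^h\rceil$ be the number of leaves ($b=n$ if $2^h\mid n$). Each leaf defines a bucket: the slots on the path from the leaf to the root of its tree. One further node, the super root, common to all buckets, is stored by the client and has unbounded capacity. A uniformly random function $\Pi$, known only to the client, assigns to every key two independent uniform buckets. A new key is stored in an empty slot of least height in its two buckets, and in the super root if they have none; an existing key is updated where it is. *RAM.* The client keeps a stash of buckets; at setup, after the items of the initial database have been stored, each bucket enters the stash independently with probability $p=\min(C/b,1)$. To read or overwrite bucket $i$, the client first downloads a bucket $d$: uniformly random if $i$ is stashed (and $i$ is removed from the stash), and $d=i$ otherwise. Blocks held in a stashed bucket take precedence over the server's copies, and an overwrite is also applied to all stashed buckets sharing the blocks. Then, with probability $p$, bucket $i$ is put into the stash and a uniformly random bucket $o$ is downloaded and uploaded again unchanged (re-encrypted); otherwise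 $o=i$ is downloaded and the current content is uploaded to it. *Queries.* A retrieval or overwrite of key $u$ makes two RAM reads, of the two buckets $\Pi(u)$ (if they coincide, the second one is a uniformly random other bucket), followed by two RAM updates of the same buckets, which leave the content unchanged except where a record is written. Blocks are opaque (encrypted) to the server, so its view consists, for each query, of the sequence of block addresses that are downloaded and uploaded. Two query sequences of the same length are adjacent if they differ, in the key or in the kind of operation (retrieval or overwrite), at exactly one position; written records are arbitrary. There is a constant $K>0$, depending only on $t$, such that the following hold. 1. For all sufficiently large $n$ (depending only on $t$), all $C\ge 1$, all finite $U$, all record sets and all initial databases: (a) the server storage has at most $Kn$ blocks; (b) with probability $1$, all answers are correct (a retrieval returns the record last stored under the key, and $\perp$ if there is none), and every query moves at most $K\log\log n$ blocks; (c) the scheme provides $\varepsilon$-differentially private access with $\varepsilon=K\log n$: for all adjacent $Q_1,Q_2$ and every set $S$ of views, $\Pr[\mathrm{view}(Q_1)\in S]\le e^{\varepsilon}\Pr[\mathrm{view}(Q_2)\in S]$. In particular it is $(\varepsilon,\delta)$-differentially private for every (negligible) $\delta\ge 0$. 2. Let $\Phi(n)=\omega(\log n)$ be eventually nonnegative, and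 let $C=C(n)\le\Phi(n)$ for all large $n$. For every $a\in\mathbb N$ there is a negligible function $\mathrm{negl}$ such that for all $n\ge 1$, all finite $U$, all record sets, all initial databases and all query sequences of length at most $n^a$ in which at most $n$ distinct keys are ever stored (initially or by overwrites), the probability that the client at some point (after the setup or after some RAM query) stores more than $K\,\Phi(n)\log\log n$ blocks, counting the stash and the super root, is at most $\mathrm{negl}(n)$. -/

import Mathlib

open Filter Asymptotics

namespace DPKVS

/-! ### Bucket arrangement: a forest of identical complete binary trees -/

/-- Every tree has `2 ^ treeHeight n` leaves: the least power of two that is `≥ ⌈log₂ n⌉`. -/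
def treeHeight (n : ℕ) : ℕ := Nat.clog 2 (Nat.clog 2 n)

/-- `⌈n / 2 ^ treeHeight n⌉` trees, so that there are at least `n` leaves, and exactly `n` of them
when the size of a tree divides `n`. -/
def treeCount (n : ℕ) : ℕ := (n + (2 ^ treeHeight n - 1)) / 2 ^ treeHeight n

/-- The number of leaves, which is the number of buckets. -/
def numBuckets (n : ℕ) : ℕ := treeCount n * 2 ^ treeHeight n

instance instNeZeroNumBuckets (n : ℕ) [NeZero n] : NeZero (numBuckets n) where
  out := by
    have hn : 0 < n := Nat.pos_of_ne_zero (NeZero.ne n)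
    have hp : 0 < 2 ^ treeHeight n := by positivity
    have h1 : 0 < treeCount n := Nat.div_pos (by omega) hp
    exact (Nat.mul_pos h1 hp).ne'

/-- Buckets are identified with leaves. -/
abbrev Bucket (n : ℕ) : Type := Fin (numBuckets n)

/-- The tree nodes stored on the server: a height `i` (leaves have height `0`) and an index among
the nodes of that height. The children of node `j` of height `i + 1` are the nodes `2 * j` and
`2 * j + 1` of height `i`, and the roots of the trees are the nodes of height `treeHeight n`. The
super root, the parent of all roots, is stored on the client and is not among the nodes here. -/
abbrev Node (n : ℕ) : Type :=
  Σ i : Fin (treeHeight n + 1), Fin (numBuckets n / 2 ^ (i : ℕ))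

theorem div_lt_numBuckets (n : ℕ) (b : Bucket n) (i : Fin (treeHeight n + 1)) :
    (b : ℕ) / 2 ^ (i : ℕ) < numBuckets n / 2 ^ (i : ℕ) :=
  Nat.div_lt_div_of_lt_of_dvd
    ((pow_dvd_pow 2 (Nat.lt_succ_iff.mp i.isLt)).trans (Dvd.intro_left _ rfl)) b.isLt

/-- The node of height `i` on the path from the leaf `b` to the root of its tree. -/
def node {n : ℕ} (b : Bucket n) (i : Fin (treeHeight n + 1)) : Node n :=
  ⟨i, ⟨(b : ℕ) / 2 ^ (i : ℕ), div_lt_numBuckets n b i⟩⟩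

/-- Addresses of the blocks on the server: every node has `t` slots, one block each. -/
abbrev Addr (n t : ℕ) : Type := Node n × Fin t

/-- A position inside a bucket: a height and a slot of the node of that height on the path. -/
abbrev Pos (n t : ℕ) : Type := Fin (treeHeight n + 1) × Fin t

/-- The server address of a position of a bucket. -/
def addr {n t : ℕ} (b : Bucket n) (x : Pos n t) : Addr n t := (node b x.1, x.2)

/-- A block: empty (a dummy), or a key with its record. -/
abbrev Block (U V : Type) : Type := Option (U × V)

/-- The content of the server part of a bucket. -/
abbrev Content (n t : ℕ) (U V : Type) : Type := Pos n t → Block U V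

/-! ### State of client and server -/

/-- The joint state of client and server. -/
structure State (n t : ℕ) (U V : Type) where
  /-- client: the secret mapping function, two buckets for every key -/
  choices : U → Bucket n × Bucket n
  /-- client: the stash of buckets of the RAM -/
  stash : Bucket n → Option (Content n t U V)
  /-- client: the super root, which is the mapping stash -/
  superRoot : List (U × V)
  /-- server: the block array -/
  server : Addr n t → Block U V

/-- The number of blocks that the client stores. -/
def State.clientBlocks {n t : ℕ} {U V : Type} (s : State n t U V) : ℕ :=
  (Finset.univ.filter fun b => (s.stash b).isSome).card * Fintype.card (Pos n t)
    + s.superRoot.length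

inductive Direction : Type
  | download
  | upload

/-- The movement of one block between client and server, as the server sees it: blocks are opaque
(encrypted), so it sees the direction and the address. -/
abbrev Transfer (n t : ℕ) : Type := Direction × Addr n t

/-- The movement of all blocks of a bucket. -/
def moveBucket {n : ℕ} (t : ℕ) (dir : Direction) (b : Bucket n) : List (Transfer n t) :=
  (List.finRange (treeHeight n + 1)).flatMap fun i =>
    (List.finRange t).map fun x => (dir, addr b (i, x))

/-- What the server sees in one RAM query: bucket `d` is downloaded in the download phase, then
bucket `o` is downloaded and uploaded in the overwrite phase. -/
def ramTransfers {n : ℕ} (t : ℕ) (d o : Bucket n) : List (Transfer n t) :=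
  moveBucket t .download d ++ (moveBucket t .download o ++ moveBucket t .upload o)

/-! ### The differentially private RAM over overlapping buckets -/

section RAM

variable {n t : ℕ} {U V : Type}

/-- The copy of the block at position `x` of bucket `b` that some stashed bucket holds, if any. -/
def stashCopy (stash : Bucket n → Option (Content n t U V)) (b : Bucket n) (x : Pos n t) :
    Option (Block U V) :=
  (List.finRange (numBuckets n)).findSome? fun c =>
    if node c x.1 = node b x.1 then (stash c).map (fun B => B x) else none

/-- Give the blocks of bucket `b` the content `B` in every stashed bucket that shares them. -/
def syncStash (stash : Bucket n → Option (Content n t U V)) (b : Bucket n)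
    (B : Content n t U V) : Bucket n → Option (Content n t U V) :=
  fun c => (stash c).map fun B' x => if node c x.1 = node b x.1 then B x else B' x

/-- Write the content `B` to bucket `b` of the server. -/
def writeBucket (server : Addr n t → Block U V) (b : Bucket n) (B : Content n t U V) :
    Addr n t → Block U V :=
  fun a => if node b a.1.1 = a.1 then B (a.1.1, a.2) else server a

/-- One RAM query to bucket `i`; `new = none` is a read (or a fake update) and `new = some B` is an
overwrite with `B`. Returns the content of the bucket after the query, what the server sees,
and the new state. The probability that the bucket enters the stash is `C / numBuckets n`. -/
noncomputable def ramQuery [NeZero n] (C : ℕ) (s : State n t U V) (i : Bucket n)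
    (new : Option (Content n t U V)) :
    PMF (Content n t U V × List (Transfer n t) × State n t U V) := do
  -- download phase
  let (B, d, stash) ← (match s.stash i with
    | some B => do
        let d ← PMF.uniformOfFintype (Bucket n)
        return (B, d, Function.update s.stash i none)
    | none =>
        return (fun x => (stashCopy s.stash i x).getD (s.server (addr i x)), i, s.stash) :
    PMF (Content n t U V × Bucket n × (Bucket n → Option (Content n t U V))))
  let B' := new.getD B
  let stash' := syncStash stash i B'
  -- overwrite phase
  let r ← PMF.uniformOfFintype (Bucket n)
  if (r : ℕ) < C then
    let o ← PMF.uniformOfFintype (Bucket n)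
    return (B', ramTransfers t d o, { s with stash := Function.update stash' i (some B') })
  else
    return (B', ramTransfers t d i,
      { s with stash := stash', server := writeBucket s.server i B' })

end RAM

/-! ### The storing algorithm -/

section Storing

variable {n t : ℕ} {U V : Type} [DecidableEq U]

/-- The position of key `u` in a bucket. -/
def findKey (u : U) (B : Content n t U V) : Option (Pos n t) :=
  (List.finRange (treeHeight n + 1)).findSome? fun i =>
    (List.finRange t).findSome? fun x =>
      if (B (i, x)).map Prod.fst = some u then some (i, x) else none

/-- An empty slot at height `i` of a bucket. -/
def emptySlot (B : Content n t U V) (i : Fin (treeHeight n + 1)) : Option (Pos n t) :=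
  ((List.finRange t).find? fun x => (B (i, x)).isNone).map fun x => (i, x)

/-- The empty position of least height in the buckets `B₁` and `B₂` (tagged `false` and `true`). -/
def lowestEmpty (B₁ B₂ : Content n t U V) : Option (Bool × Pos n t) :=
  (List.finRange (treeHeight n + 1)).findSome? fun i =>
    match emptySlot B₁ i with
    | some x => some (false, x)
    | none => (emptySlot B₂ i).map fun x => (true, x)

/-- Store record `v` under key `u`, given the contents of the two buckets of `u` and the super root:
an existing key is updated where it is, a new key goes to the empty slot of least height, and to the
super root if the two buckets have none. Returns the new super root and, for each of the
two buckets, the new content if it changes. -/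
def store (u : U) (v : V) (B₁ B₂ : Content n t U V) (root : List (U × V)) :
    List (U × V) × Option (Content n t U V) × Option (Content n t U V) :=
  match findKey u B₁, findKey u B₂ with
  | some x, _ => (root, some (Function.update B₁ x (some (u, v))), none)
  | none, some x => (root, none, some (Function.update B₂ x (some (u, v))))
  | none, none =>
    if u ∈ root.map Prod.fst then
      (root.map fun e => if e.1 = u then (u, v) else e, none, none)
    else match lowestEmpty B₁ B₂ with
      | some (false, x) => (root, some (Function.update B₁ x (some (u, v))), none)
      | some (true, x) => (root, none, some (Function.update B₂ x (some (u, v))))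
      | none => (root ++ [(u, v)], none, none)

/-- The record of key `u`, given the contents of its two buckets and the super root. -/
def retrieve (u : U) (B₁ B₂ : Content n t U V) (root : List (U × V)) : Option V :=
  match findKey u B₁, findKey u B₂ with
  | some x, _ => (B₁ x).map Prod.snd
  | none, some x => (B₂ x).map Prod.snd
  | none, none => (root.find? fun e => e.1 = u).map Prod.snd

end Storing

/-! ### The key-value storage scheme -/

/-- An operation on a key: a retrieval, or an overwrite (insertion or update) with a record. -/
inductive Op (V : Type) : Type
  | read : Op V
  | write (v : V) : Op V

abbrev Query (U V : Type) : Type := U × Op V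

def Op.isWrite {V : Type} : Op V → Bool
  | .read => false
  | .write _ => true

/-- The key and the kind of operation of a query. -/
def queryKind {U V : Type} (q : Query U V) : U × Bool := (q.1, q.2.isWrite)

/-- What is recorded of one query of the key-value storage. -/
structure StepLog (n t : ℕ) (V : Type) where
  /-- the answer to the client; `none` stands for `⊥` -/
  answer : Option V
  /-- what the server sees -/
  transfers : List (Transfer n t)
  /-- the number of blocks on the client after each RAM query -/
  clientSizes : List ℕ

/-- What is recorded of an execution: the number of blocks on the client after the setup, and all
queries. -/
structure Execution (n t : ℕ) (V : Type) where
  setupSize : ℕ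
  steps : List (StepLog n t V)

section KVS

variable {n t : ℕ} {U V : Type}

/-- The answers given in an execution. -/
def Execution.answers (e : Execution n t V) : List (Option V) := e.steps.map StepLog.answer

/-- The view of the server: the block movements of each query. -/
def Execution.view (e : Execution n t V) : List (List (Transfer n t)) :=
  e.steps.map StepLog.transfers

/-- The numbers of blocks on the client throughout an execution. -/
def Execution.clientSizes (e : Execution n t V) : List ℕ :=
  e.setupSize :: e.steps.flatMap StepLog.clientSizes

/-- A second bucket to query: the second choice if it differs from the first, and otherwise a
uniformly random other bucket (if there is one). -/
noncomputable def secondBucket (b : Bucket n × Bucket n) : PMF (Bucket n) :=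
  if b.2 ≠ b.1 then PMF.pure b.2
  else if h : (Finset.univ.erase b.1).Nonempty then PMF.uniformOfFinset _ h
  else PMF.pure b.1

variable [DecidableEq U]

/-- One query of the key-value storage: two RAM reads of the buckets of the key, then two RAM
updates of the same buckets, which are fake unless the content of the bucket changes. -/
noncomputable def kvsQuery [NeZero n] (C : ℕ) (s : State n t U V) (q : Query U V) :
    PMF (StepLog n t V × State n t U V) := do
  let b₁ := (s.choices q.1).1
  let b₂ ← secondBucket (s.choices q.1)
  let (B₁, T₁, s₁) ← ramQuery C s b₁ none
  let (B₂', T₂, s₂) ← ramQuery C s₁ b₂ none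
  -- a random padding bucket is ignored
  let B₂ := if (s.choices q.1).2 = b₁ then B₁ else B₂'
  let (ans, root, new₁, new₂) := match q.2 with
    | .read => (retrieve q.1 B₁ B₂ s₂.superRoot, s₂.superRoot, none, none)
    | .write v => (none, store q.1 v B₁ B₂ s₂.superRoot)
  let (_, T₃, s₃) ← ramQuery C { s₂ with superRoot := root } b₁ new₁
  let (_, T₄, s₄) ← ramQuery C s₃ b₂ new₂
  return (⟨ans, T₁ ++ T₂ ++ T₃ ++ T₄,
    [s₁.clientBlocks, s₂.clientBlocks, s₃.clientBlocks, s₄.clientBlocks]⟩, s₄)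

/-- Run a sequence of queries. -/
noncomputable def runQueries [NeZero n] (C : ℕ) :
    List (Query U V) → State n t U V → PMF (List (StepLog n t V))
  | [], _ => PMF.pure []
  | q :: qs, s => do
      let (log, s') ← kvsQuery C s q
      let logs ← runQueries C qs s'
      return log :: logs

/-- Store one item of the initial database (nothing is stashed yet). -/
def initStore (s : State n t U V) (e : U × V) : State n t U V :=
  let b := s.choices e.1
  let (root, new₁, new₂) := store e.1 e.2 (fun x => s.server (addr b.1 x))
    (fun x => s.server (addr b.2 x)) s.superRoot
  let server₁ := (new₁.map (writeBucket s.server b.1)).getD s.server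
  let server₂ := (new₂.map (writeBucket server₁ b.2)).getD server₁
  { s with superRoot := root, server := server₂ }

/-- The setup: draw the mapping function uniformly at random (two independent uniform buckets for
every key), store the items of the initial database `D` one after the other, and put each bucket
into the stash independently with probability `C / numBuckets n`. -/
noncomputable def setup (n t : ℕ) [NeZero n] [Fintype U] (C : ℕ) (D : List (U × V)) :
    PMF (State n t U V) := do
  let choices ← PMF.uniformOfFintype (U → Bucket n × Bucket n)
  let s := D.foldl initStore
    (⟨choices, fun _ => none, [], fun _ => none⟩ : State n t U V)
  let r ← PMF.uniformOfFintype (Bucket n → Bucket n)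
  return { s with
    stash := fun b => if (r b : ℕ) < C then some (fun x => s.server (addr b x)) else none }

/-- The random execution of the scheme on initial database `D` and query sequence `Q`. -/
noncomputable def execute (n t : ℕ) [NeZero n] [Fintype U] (C : ℕ) (D : List (U × V))
    (Q : List (Query U V)) : PMF (Execution n t V) := do
  let s ← setup n t C D
  let logs ← runQueries C Q s
  return ⟨s.clientBlocks, logs⟩

/-! ### What a key-value storage has to compute -/

/-- The answers of an ideal dictionary: a retrieval returns the record last written under the key,
or `none` if there is none, and an overwrite returns nothing. -/
def idealAnswers : List (Query U V) → (U → Option V) → List (Option V)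
  | [], _ => []
  | (u, .read) :: qs, m => m u :: idealAnswers qs m
  | (u, .write v) :: qs, m => none :: idealAnswers qs (Function.update m u (some v))

/-- The dictionary of an initial database. -/
def initialDict (D : List (U × V)) : U → Option V :=
  D.foldl (fun m e => Function.update m e.1 (some e.2)) (fun _ => none)

/-- The keys that are ever stored: those of the initial database and those that are written. -/
def storedKeys (D : List (U × V)) (Q : List (Query U V)) : Finset U :=
  (D.map Prod.fst).toFinset ∪ ((Q.filter fun q => q.2.isWrite).map Prod.fst).toFinset

end KVS

/-! ### Differentially private access -/

/-- The probability of an event. -/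
noncomputable def prob {α : Type} (p : PMF α) (S : Set α) : ℝ := (p.toOuterMeasure S).toReal

/-- `(ε, δ)`-differentially private access: for all query sequences of the same length that differ,
in key or kind of operation, at exactly one query (the records that are written are
arbitrary). -/
def DPAccess {U V W : Type} [DecidableEq U] (view : List (Query U V) → PMF W) (ε δ : ℝ) : Prop :=
  ∀ (l : ℕ) (Q₁ Q₂ : Fin l → Query U V),
    hammingDist (fun j => queryKind (Q₁ j)) (fun j => queryKind (Q₂ j)) = 1 →
    ∀ S : Set W,
      prob (view (List.ofFn Q₁)) S ≤ Real.exp ε * prob (view (List.ofFn Q₂)) S + δ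

end DPKVS

/-! Correctness rests on two invariants. `State.Represents`: every stashed bucket agrees with one
memory `M`, and so does the server wherever no stashed bucket covers it. `Implements`: `M` together
with the super root encodes the dictionary, each key being stored once, on one of its own two paths
or in the super root. RAM queries preserve the first, storing preserves the second.

Privacy. What the server sees depends on the state only through the mapping and the set `S` of
stashed buckets, never through contents. Given the list of buckets queried, the view is thus the
output of a hidden Markov chain on sets `S`. Fix an output. Both the weight of reaching `S` with the
past output (`forward`) and the probability of the future output from `S` (`backward`, `runExpect`)
drop by at most a factor `M` when a bucket is added to `S` (`Upward`). When bucket `i` of one RAM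
query is replaced by `i'`, move the mass at `S` to `S ∪ {i, i'}`: with `i'` stashed before and after
the query, every pair of downloaded and overwritten buckets has probability at least `1 / M ^ 2`.
The move is at most four-to-one, so the output probability changes by a factor at most `8 * M ^ 6`
(`sum_backward_le`). With `b` buckets, `M = b ^ 2` suffices, and a query makes four RAM queries, so
the ratio is polynomial in `n`, uniformly over all outputs; hence `δ = 0`.

Client storage. After a RAM query to `i`, bucket `i` is stashed with probability `p` whatever
happened before, so the product Bernoulli law of the stash is stationary (`expect_stashNext`), and
at each time its size has a Chernoff tail. The super root is a deterministic function of the mapping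
and the items stored so far. Layered induction bounds it: a new key goes above height `i` only if
the height-`i` nodes of both its buckets are full. If at most `β` items lie at height `i` or more,
at most `β / t` nodes there are full, and they cover a fraction at most `(β / t) * 2 ^ i / b` of the
leaves; two independent choices square this fraction. The thresholds `loadBound` therefore fall
doubly exponentially and are below a constant at the root height, where `2 ^ h ≥ log₂ n`; from the
point where they pass below `3 * φ`, that cutoff is used instead. Each level fails with probability
at most `exp (-φ)`, and union bounds over levels and times leave a polynomial times `exp (-Φ n)`,
which is negligible since `Φ = ω(log n)`. -/

namespace DPKVS

/-! ### Expectations of extended nonnegative functions -/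

section Expect

open scoped ENNReal

variable {α β : Type}

/-- The expectation of a nonnegative function. -/
noncomputable def expect (p : PMF α) (f : α → ℝ≥0∞) : ℝ≥0∞ := ∑' a, p a * f a

theorem expect_pure (a : α) (f : α → ℝ≥0∞) : expect (PMF.pure a) f = f a := by
  classical
  unfold expect
  rw [tsum_eq_single a]
  · simp
  · intro b hb
    simp [PMF.pure_apply, hb]

theorem expect_bind (p : PMF α) (g : α → PMF β) (f : β → ℝ≥0∞) :
    expect (p.bind g) f = expect p fun a => expect (g a) f := by
  unfold expect
  simp only [PMF.bind_apply, ← ENNReal.tsum_mul_right, ← ENNReal.tsum_mul_left]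
  rw [ENNReal.tsum_comm]
  simp only [mul_assoc]

theorem expect_map (p : PMF α) (g : α → β) (f : β → ℝ≥0∞) :
    expect (p.map g) f = expect p fun a => f (g a) := by
  simp only [PMF.map, expect_bind, Function.comp, expect_pure]

theorem expect_mono (p : PMF α) {f g : α → ℝ≥0∞} (h : ∀ a ∈ p.support, f a ≤ g a) :
    expect p f ≤ expect p g := by
  refine ENNReal.tsum_le_tsum fun a => ?_
  by_cases ha : a ∈ p.support
  · exact mul_le_mul_right (h a ha) _
  · rw [(p.apply_eq_zero_iff a).2 ha, zero_mul, zero_mul]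

theorem expect_congr (p : PMF α) {f g : α → ℝ≥0∞} (h : ∀ a ∈ p.support, f a = g a) :
    expect p f = expect p g :=
  le_antisymm (expect_mono p fun a ha => (h a ha).le) (expect_mono p fun a ha => (h a ha).ge)

theorem expect_const (p : PMF α) (c : ℝ≥0∞) : expect p (fun _ => c) = c := by
  unfold expect
  rw [ENNReal.tsum_mul_right, p.tsum_coe, one_mul]

theorem expect_add (p : PMF α) (f g : α → ℝ≥0∞) :
    expect p (fun a => f a + g a) = expect p f + expect p g := by
  unfold expect
  simp only [mul_add, ENNReal.tsum_add]

theorem expect_const_mul (p : PMF α) (c : ℝ≥0∞) (f : α → ℝ≥0∞) :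
    expect p (fun a => c * f a) = c * expect p f := by
  unfold expect
  simp only [mul_left_comm _ c, ENNReal.tsum_mul_left]

theorem expect_mul_const (p : PMF α) (c : ℝ≥0∞) (f : α → ℝ≥0∞) :
    expect p (fun a => f a * c) = expect p f * c := by
  simp only [mul_comm _ c, expect_const_mul]

theorem expect_comm (p : PMF α) (q : PMF β) (f : α → β → ℝ≥0∞) :
    expect p (fun a => expect q (f a)) = expect q fun b => expect p fun a => f a b := by
  unfold expect
  simp only [← ENNReal.tsum_mul_left]
  rw [ENNReal.tsum_comm]
  simp only [mul_left_comm]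

theorem expect_sum {ι : Type} (p : PMF α) (s : Finset ι) (f : ι → α → ℝ≥0∞) :
    expect p (fun a => ∑ j ∈ s, f j a) = ∑ j ∈ s, expect p (f j) := by
  classical
  induction s using Finset.induction_on with
  | empty => simp [expect_const]
  | insert j s hj ih => simp only [Finset.sum_insert hj, expect_add, ih]

theorem expect_uniform [Fintype α] [Nonempty α] (f : α → ℝ≥0∞) :
    expect (PMF.uniformOfFintype α) f = (Fintype.card α : ℝ≥0∞)⁻¹ * ∑ a, f a := by
  simp only [expect, PMF.uniformOfFintype_apply, tsum_fintype, Finset.mul_sum]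

theorem toOuterMeasure_eq_expect (p : PMF α) (S : Set α) :
    p.toOuterMeasure S = expect p (S.indicator 1) := by
  rw [PMF.toOuterMeasure_apply, expect]
  refine tsum_congr fun a => ?_
  by_cases h : a ∈ S <;> simp [h]

theorem prob_eq_expect (p : PMF α) (S : Set α) : prob p S = (expect p (S.indicator 1)).toReal := by
  rw [prob, toOuterMeasure_eq_expect]

theorem expect_indicator_le_one (p : PMF α) (S : Set α) : expect p (S.indicator 1) ≤ 1 := by
  rw [← expect_const p 1]
  exact expect_mono p fun a _ => Set.indicator_le_self' (by simp) a

/-- Markov's inequality. -/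
theorem expect_indicator_le (p : PMF α) (S : Set α) (f : α → ℝ≥0∞) (h : ∀ a ∈ S, 1 ≤ f a) :
    expect p (S.indicator 1) ≤ expect p f := by
  refine expect_mono p fun a _ => ?_
  by_cases ha : a ∈ S
  · simpa [ha] using h a ha
  · simp [ha]

/-- A uniformly random function can be drawn by drawing it and then one of its values again. -/
theorem expect_uniform_resample {ι : Type} [Fintype ι] [DecidableEq ι] [Fintype α] [Nonempty α]
    (i : ι) (f : (ι → α) → ℝ≥0∞) :
    expect (PMF.uniformOfFintype (ι → α)) f =
      expect (PMF.uniformOfFintype (ι → α)) fun c =>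
        expect (PMF.uniformOfFintype α) fun x => f (Function.update c i x) := by
  simp only [expect_uniform]
  congr 1
  -- Split a function into its value at `i` and the rest. The resampled summand ignores the old
  -- value, so summing over it gives a factor `card α` that cancels the inverse.
  have key : ∀ g : (ι → α) → ℝ≥0∞,
      ∑ c, g c = ∑ c' : {j // j ≠ i} → α, ∑ y : α, g ((Equiv.funSplitAt i α).symm (y, c')) := by
    intro g
    rw [← (Equiv.funSplitAt i α).symm.sum_comp, Fintype.sum_prod_type, Finset.sum_comm]
  have upd : ∀ (c' : {j // j ≠ i} → α) (y x : α),
      Function.update ((Equiv.funSplitAt i α).symm (y, c')) i x =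
        (Equiv.funSplitAt i α).symm (x, c') := by
    intro c' y x
    ext j
    by_cases h : j = i
    · subst h; simp
    · simp [h]
  rw [key f, key fun c => (Fintype.card α : ℝ≥0∞)⁻¹ * ∑ x, f (Function.update c i x)]
  refine Finset.sum_congr rfl fun c' _ => ?_
  simp only [upd, Finset.sum_const, Finset.card_univ, nsmul_eq_mul]
  rw [← mul_assoc, ENNReal.mul_inv_cancel, one_mul]
  · simp
  · exact ENNReal.natCast_ne_top _

end Expect

/-! ### A RAM query as a deterministic function of its randomness -/

section RAM

variable {n t : ℕ} {U V : Type}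

/-- The randomness of a RAM query to bucket `i`, which is stashed if and only if `m`: the downloaded
bucket, the overwritten bucket, and whether `i` is put into the stash. -/
noncomputable def ramNoise [NeZero n] (C : ℕ) (i : Bucket n) (m : Bool) :
    PMF (Bucket n × Bucket n × Bool) :=
  (if m then PMF.uniformOfFintype (Bucket n) else PMF.pure i).bind fun d =>
    (PMF.uniformOfFintype (Bucket n)).bind fun r =>
      if (r : ℕ) < C then (PMF.uniformOfFintype (Bucket n)).map fun o => (d, o, true)
      else PMF.pure (d, i, false)

/-- The content of bucket `i` as the client reads it. -/
def ramContent (s : State n t U V) (i : Bucket n) : Content n t U V :=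
  match s.stash i with
  | some B => B
  | none => fun x => (stashCopy s.stash i x).getD (s.server (addr i x))

/-- The state after a RAM query to bucket `i` that puts `i` into the stash if `m`. -/
def ramNext (s : State n t U V) (i : Bucket n) (new : Option (Content n t U V)) (m : Bool) :
    State n t U V :=
  let B' := new.getD (ramContent s i)
  let stash' := syncStash (Function.update s.stash i none) i B'
  if m then { s with stash := Function.update stash' i (some B') }
  else { s with stash := stash', server := writeBucket s.server i B' }

/-- The buckets in the stash. -/
def State.stashed (s : State n t U V) : Finset (Bucket n) :=
  Finset.univ.filter fun b => (s.stash b).isSome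

theorem mem_stashed {s : State n t U V} {b : Bucket n} :
    b ∈ s.stashed ↔ (s.stash b).isSome := by
  simp [State.stashed]

/-- Separates the coins from the data: their law depends on the state only through whether `i` is
stashed, which is what makes the view independent of the contents. -/
theorem ramQuery_eq [NeZero n] (C : ℕ) (s : State n t U V) (i : Bucket n)
    (new : Option (Content n t U V)) :
    ramQuery C s i new = (ramNoise C i (decide (i ∈ s.stashed))).map fun ω =>
      (new.getD (ramContent s i), ramTransfers t ω.1 ω.2.1, ramNext s i new ω.2.2) := by
  have h0 : ∀ {α β : Type} (p : PMF α) (f : α → PMF β), (p >>= f) = p.bind f := fun _ _ => rfl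
  have h1 : ∀ {α : Type} (a : α), (pure a : PMF α) = PMF.pure a := fun _ => rfl
  unfold ramQuery ramNoise
  simp only [mem_stashed, PMF.map_bind, apply_ite (PMF.map _), PMF.map_comp, PMF.pure_map]
  rcases h : s.stash i with _ | B
  · have hu : Function.update s.stash i none = s.stash := by rw [← h, Function.update_eq_self]
    simp only [h0, h1, PMF.pure_bind, ramNext, ramContent, h, hu]
    simp [PMF.map, Function.comp_def]
  · simp only [h0, h1, PMF.bind_bind, PMF.pure_bind, ramNext, ramContent, h]
    simp [PMF.map, Function.comp_def]

theorem stashed_ramNext (s : State n t U V) (i : Bucket n) (new : Option (Content n t U V))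
    (m : Bool) :
    (ramNext s i new m).stashed = if m then insert i s.stashed else s.stashed.erase i := by
  ext b
  cases m <;> by_cases h : b = i <;> simp [mem_stashed, ramNext, syncStash, h]

@[simp] theorem choices_ramNext (s : State n t U V) (i : Bucket n)
    (new : Option (Content n t U V)) (m : Bool) : (ramNext s i new m).choices = s.choices := by
  cases m <;> rfl

@[simp] theorem superRoot_ramNext (s : State n t U V) (i : Bucket n)
    (new : Option (Content n t U V)) (m : Bool) :
    (ramNext s i new m).superRoot = s.superRoot := by
  cases m <;> rfl

/-! ### The memory that a state represents -/

/-- The state represents the memory `M`: all stashed buckets hold its content, and so does the server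
outside of them. -/
structure State.Represents (s : State n t U V) (M : Addr n t → Block U V) : Prop where
  stash : ∀ c B, s.stash c = some B → ∀ x, B x = M (addr c x)
  server : ∀ a : Addr n t, (∀ c, (s.stash c).isSome → node c a.1.1 ≠ a.1) → s.server a = M a

theorem addr_of_node_eq {b : Bucket n} {a : Addr n t} (h : node b a.1.1 = a.1) :
    addr b (a.1.1, a.2) = a := Prod.ext h rfl

/-- Any stashed copy of a block is current; if no stashed bucket shares the block, the server's copy
is current. -/
theorem State.Represents.ramContent {s : State n t U V} {M : Addr n t → Block U V}
    (h : s.Represents M) (i : Bucket n) : ramContent s i = fun x => M (addr i x) := by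
  unfold DPKVS.ramContent
  rcases hi : s.stash i with _ | B
  · funext x
    simp only
    rcases hc : stashCopy s.stash i x with _ | y
    · refine h.server _ fun c hc' hn => ?_
      rw [stashCopy, List.findSome?_eq_none_iff] at hc
      have := hc c (List.mem_finRange c)
      have hn' : node c x.1 = node i x.1 := hn
      rw [if_pos hn', Option.map_eq_none_iff] at this
      simp [this] at hc'
    · rw [stashCopy] at hc
      obtain ⟨c, -, hc⟩ := List.exists_of_findSome?_eq_some hc
      split_ifs at hc with hn
      obtain ⟨B, hB, rfl⟩ := Option.map_eq_some_iff.1 hc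
      simp only [Option.getD_some]
      rw [h.stash c B hB x, addr, hn, addr]
  · funext x
    exact h.stash i B hi x

theorem writeBucket_addr (M : Addr n t → Block U V) (i : Bucket n) (B : Content n t U V)
    (x : Pos n t) : writeBucket M i B (addr i x) = B x := by
  simp [writeBucket, addr, node]

theorem writeBucket_self (M : Addr n t → Block U V) (i : Bucket n) :
    writeBucket M i (fun x => M (addr i x)) = M := by
  funext a
  unfold writeBucket
  split_ifs with h
  · exact congrArg M (addr_of_node_eq h)
  · rfl

/-- If `i` ends up stashed, its server blocks may be stale, which the invariant allows. If not,
writing bucket `i` back refreshes exactly the blocks that lose their cover when `i` leaves the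
stash. -/
theorem State.Represents.ramNext {s : State n t U V} {M : Addr n t → Block U V}
    (h : s.Represents M) (i : Bucket n) (new : Option (Content n t U V)) (m : Bool) :
    (ramNext s i new m).Represents ((new.map (writeBucket M i)).getD M) := by
  -- A read counts as an overwrite with the content just read, so both kinds of query are one case.
  have hM : (new.map (writeBucket M i)).getD M =
      writeBucket M i (new.getD (DPKVS.ramContent s i)) := by
    cases new
    · simp [h.ramContent, writeBucket_self]
    · rfl
  rw [hM]
  generalize hB : new.getD (DPKVS.ramContent s i) = B'
  have sync : ∀ c B, syncStash (Function.update s.stash i none) i B' c = some B →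
      ∀ x, B x = writeBucket M i B' (addr c x) := by
    intro c B hc x
    unfold syncStash at hc
    obtain ⟨B₀, hB₀, rfl⟩ := Option.map_eq_some_iff.1 hc
    have hci : c ≠ i := by rintro rfl; simp at hB₀
    rw [Function.update_of_ne hci] at hB₀
    have h1 := h.stash c B₀ hB₀ x
    simp only [writeBucket]
    by_cases hn : node c x.1 = node i x.1
    · have : node i (addr c x).1.1 = (addr c x).1 := hn.symm
      rw [if_pos hn, if_pos this]; rfl
    · have : ¬ node i (addr c x).1.1 = (addr c x).1 := fun h' => hn h'.symm
      rw [if_neg hn, if_neg this, h1]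
  cases m
  · constructor
    · intro c B hc
      exact sync c B (by simpa [DPKVS.ramNext, hB] using hc)
    · intro a ha
      simp only [DPKVS.ramNext, hB, Bool.false_eq_true, if_false] at ha ⊢
      unfold writeBucket
      split_ifs with hn
      · rfl
      · refine h.server a fun c hc => ?_
        by_cases hci : c = i
        · rwa [hci]
        · exact ha c (by simpa [syncStash, hci] using hc)
  · constructor
    · intro c B hc
      simp only [DPKVS.ramNext, hB, if_true] at hc
      by_cases hci : c = i
      · subst hci
        simp only [Function.update_self, Option.some.injEq] at hc
        subst hc
        exact fun x => (writeBucket_addr _ _ _ _).symm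
      · rw [Function.update_of_ne hci] at hc
        exact sync c B hc
    · intro a ha
      simp only [DPKVS.ramNext, hB, if_true] at ha ⊢
      have hi : ¬ node i a.1.1 = a.1 := ha i (by simp)
      unfold writeBucket
      rw [if_neg hi]
      refine h.server a fun c hc => ?_
      by_cases hci : c = i
      · rwa [hci]
      · exact ha c (by simpa [syncStash, hci] using hc)

end RAM

/-! ### The storing algorithm on a memory -/

section Storing

variable {n t : ℕ} {U V : Type}

theorem writeBucket_update (M : Addr n t → Block U V) (b : Bucket n) (x : Pos n t)
    (y : Block U V) :
    writeBucket M b (Function.update (fun x => M (addr b x)) x y) =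
      Function.update M (addr b x) y := by
  funext a
  unfold writeBucket
  by_cases h : a = addr b x
  · subst h
    rw [Function.update_self, if_pos (by rfl)]
    exact Function.update_self ..
  · rw [Function.update_of_ne h]
    split_ifs with hn
    · have h1 := addr_of_node_eq (t := t) hn
      rw [Function.update_of_ne]
      · exact congrArg M h1
      · rintro rfl
        exact h h1.symm
    · rfl

theorem emptySlot_eq_none {B : Content n t U V} {i : Fin (treeHeight n + 1)}
    (h : emptySlot B i = none) (x : Fin t) : B (i, x) ≠ none := by
  simp only [emptySlot, Option.map_eq_none_iff, List.find?_eq_none] at h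
  have := h x (List.mem_finRange x)
  intro hx
  simp [hx] at this

theorem emptySlot_eq_some {B : Content n t U V} {i : Fin (treeHeight n + 1)} {x : Pos n t}
    (h : emptySlot B i = some x) : x.1 = i ∧ B x = none := by
  simp only [emptySlot, Option.map_eq_some_iff] at h
  obtain ⟨y, hy, rfl⟩ := h
  exact ⟨rfl, by simpa using List.find?_some hy⟩

theorem lowestEmpty_eq_none {B₁ B₂ : Content n t U V} (h : lowestEmpty B₁ B₂ = none)
    (x : Pos n t) : B₁ x ≠ none ∧ B₂ x ≠ none := by
  unfold lowestEmpty at h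
  rw [List.findSome?_eq_none_iff] at h
  have h1 := h x.1 (List.mem_finRange _)
  rcases h2 : emptySlot B₁ x.1 with _ | y
  · rw [h2] at h1
    simp only [Option.map_eq_none_iff] at h1
    exact ⟨emptySlot_eq_none h2 x.2, emptySlot_eq_none h1 x.2⟩
  · simp [h2] at h1

theorem lowestEmpty_eq_some {B₁ B₂ : Content n t U V} {y : Bool × Pos n t}
    (h : lowestEmpty B₁ B₂ = some y) :
    (if y.1 then B₂ else B₁) y.2 = none ∧
      ∀ x : Pos n t, x.1 < y.2.1 → B₁ x ≠ none ∧ B₂ x ≠ none := by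
  unfold lowestEmpty at h
  rw [List.findSome?_eq_some_iff] at h
  obtain ⟨l₁, i, l₂, hl, hi, hlt⟩ := h
  have hy : (if y.1 then B₂ else B₁) y.2 = none ∧ y.2.1 = i := by
    rcases h2 : emptySlot B₁ i with _ | z
    · simp only [h2, Option.map_eq_some_iff] at hi
      obtain ⟨z, hz, rfl⟩ := hi
      exact ⟨(emptySlot_eq_some hz).2, (emptySlot_eq_some hz).1⟩
    · simp only [h2, Option.some.injEq] at hi
      subst hi
      exact ⟨(emptySlot_eq_some h2).2, (emptySlot_eq_some h2).1⟩
  refine ⟨hy.1, fun x hx => ?_⟩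
  rw [hy.2] at hx
  -- The heights are scanned in increasing order, so every smaller height was tried before `i` and
  -- gave nothing.
  have hmem : x.1 ∈ l₁ := by
    have hp := List.pairwise_lt_finRange (treeHeight n + 1)
    have hx' := List.mem_finRange x.1
    rw [hl] at hp hx'
    rw [List.pairwise_append] at hp
    rcases List.mem_append.1 hx' with h' | h'
    · exact h'
    · rcases List.mem_cons.1 h' with h' | h'
      · exact absurd h' hx.ne
      · exact absurd ((List.pairwise_cons.1 hp.2.1).1 _ h') hx.not_gt
  have h1 := hlt _ hmem
  rcases h2 : emptySlot B₁ x.1 with _ | z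
  · rw [h2] at h1
    simp only [Option.map_eq_none_iff] at h1
    exact ⟨emptySlot_eq_none h2 x.2, emptySlot_eq_none h1 x.2⟩
  · simp [h2] at h1

/-- The bucket choice `b` contains the address `a`. -/
def OnPath (b : Bucket n × Bucket n) (a : Addr n t) : Prop :=
  node b.1 a.1.1 = a.1 ∨ node b.2 a.1.1 = a.1

theorem OnPath.exists_pos {b : Bucket n × Bucket n} {a : Addr n t} (h : OnPath b a) :
    a = addr b.1 (a.1.1, a.2) ∨ a = addr b.2 (a.1.1, a.2) :=
  h.imp (fun h => (addr_of_node_eq h).symm) fun h => (addr_of_node_eq h).symm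

/-- The memory `M` and the super root implement the dictionary `m`. -/
structure Implements (c : U → Bucket n × Bucket n) (M : Addr n t → Block U V)
    (root : List (U × V)) (m : U → Option V) : Prop where
  mem : ∀ a u v, M a = some (u, v) → m u = some v ∧ OnPath (c u) a
  inRoot : ∀ e ∈ root, m e.1 = some e.2
  complete : ∀ u v, m u = some v → (∃ a, M a = some (u, v)) ∨ (u, v) ∈ root
  unique : ∀ a a' u v v', M a = some (u, v) → M a' = some (u, v') → a = a'
  disjoint : ∀ a u v, M a = some (u, v) → u ∉ root.map Prod.fst

/-- A stored key lies on one of its own two paths or in the super root, so a local search that fails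
shows that the key is not stored at all. -/
theorem Implements.not_mem_of_none {c : U → Bucket n × Bucket n} {M : Addr n t → Block U V}
    {root : List (U × V)} {m : U → Option V} (h : Implements c M root m) {u : U}
    (hr : u ∉ root.map Prod.fst) (hM : ∀ a, OnPath (c u) a → ∀ v, M a ≠ some (u, v)) :
    m u = none := by
  rcases hm : m u with _ | v
  · rfl
  · rcases h.complete u v hm with ⟨a, ha⟩ | h'
    · exact absurd ha (hM a (h.mem a u v ha).2 v)
    · exact absurd (List.mem_map_of_mem h') hr

variable [DecidableEq U]

/-- Store a record in a memory and a super root. -/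
def storeIn (b : Bucket n × Bucket n) (u : U) (v : V) (M : Addr n t → Block U V)
    (root : List (U × V)) : (Addr n t → Block U V) × List (U × V) :=
  let r := store u v (fun x => M (addr b.1 x)) (fun x => M (addr b.2 x)) root
  let M₁ := (r.2.1.map (writeBucket M b.1)).getD M
  ((r.2.2.map (writeBucket M₁ b.2)).getD M₁, r.1)

theorem initStore_eq (s : State n t U V) (e : U × V) :
    initStore s e =
      { s with
        server := (storeIn (s.choices e.1) e.1 e.2 s.server s.superRoot).1
        superRoot := (storeIn (s.choices e.1) e.1 e.2 s.server s.superRoot).2 } := rfl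

theorem findKey_eq_some {u : U} {B : Content n t U V} {x : Pos n t} (h : findKey u B = some x) :
    ∃ v, B x = some (u, v) := by
  unfold findKey at h
  obtain ⟨i, -, h⟩ := List.exists_of_findSome?_eq_some h
  obtain ⟨y, -, h⟩ := List.exists_of_findSome?_eq_some h
  obtain ⟨h', h⟩ := Option.ite_none_right_eq_some.1 h
  obtain rfl := Option.some.inj h
  obtain ⟨⟨u', v⟩, hb, rfl⟩ := Option.map_eq_some_iff.1 h'
  exact ⟨v, hb⟩

theorem findKey_eq_none {u : U} {B : Content n t U V} (h : findKey u B = none) (x : Pos n t)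
    (v : V) : B x ≠ some (u, v) := by
  intro hx
  unfold findKey at h
  rw [List.findSome?_eq_none_iff] at h
  have h1 := h x.1 (List.mem_finRange _)
  rw [List.findSome?_eq_none_iff] at h1
  have h2 := h1 x.2 (List.mem_finRange _)
  simp [hx] at h2

/-- Needed when the two choices of a key coincide: the second RAM bucket is then random padding and
must not be written. It holds because the first content always takes precedence. -/
theorem store_same_snd (u : U) (v : V) (B : Content n t U V) (root : List (U × V)) :
    (store u v B B root).2.2 = none := by
  unfold store
  rcases h : findKey u B with _ | x
  · simp only
    split_ifs
    · rfl
    · rcases h1 : lowestEmpty B B with _ | ⟨b, x⟩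
      · rfl
      · cases b
        · rfl
        · exfalso
          unfold lowestEmpty at h1
          obtain ⟨i, -, h1⟩ := List.exists_of_findSome?_eq_some h1
          rcases h2 : emptySlot B i with _ | z <;> simp [h2] at h1
  · rfl

/-- What `storeIn` does: it updates a block, updates the super root, fills an empty slot of least
height, or extends the super root. -/
inductive StoreCase (b : Bucket n × Bucket n) (u : U) (v : V) (M : Addr n t → Block U V)
    (root : List (U × V)) : (Addr n t → Block U V) × List (U × V) → Prop
  | update (a : Addr n t) (v₀ : V) : M a = some (u, v₀) →
      StoreCase b u v M root (Function.update M a (some (u, v)), root)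
  | updateRoot : u ∈ root.map Prod.fst →
      StoreCase b u v M root (M, root.map fun e => if e.1 = u then (u, v) else e)
  | fill (a : Addr n t) : M a = none → OnPath b a →
      u ∉ root.map Prod.fst →
      (∀ a', OnPath b a' → ∀ v, M a' ≠ some (u, v)) →
      (∀ x : Pos n t, x.1 < a.1.1 → M (addr b.1 x) ≠ none ∧ M (addr b.2 x) ≠ none) →
      StoreCase b u v M root (Function.update M a (some (u, v)), root)
  | extend : u ∉ root.map Prod.fst → (∀ a', OnPath b a' → ∀ v, M a' ≠ some (u, v)) →
      (∀ x : Pos n t, M (addr b.1 x) ≠ none ∧ M (addr b.2 x) ≠ none) →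
      StoreCase b u v M root (M, root ++ [(u, v)])

theorem storeCase_storeIn (b : Bucket n × Bucket n) (u : U) (v : V) (M : Addr n t → Block U V)
    (root : List (U × V)) : StoreCase b u v M root (storeIn b u v M root) := by
  unfold storeIn store
  rcases h1 : findKey u (fun x => M (addr b.1 x)) with _ | x
  · rcases h2 : findKey u (fun x => M (addr b.2 x)) with _ | x
    · have hno : ∀ a', OnPath b a' → ∀ v, M a' ≠ some (u, v) := by
        intro a' ha' v
        rcases ha'.exists_pos with h | h <;> rw [h]
        · exact findKey_eq_none h1 _ v
        · exact findKey_eq_none h2 _ v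
      simp only
      by_cases hr : u ∈ root.map Prod.fst
      · rw [if_pos hr]
        exact .updateRoot hr
      · rw [if_neg hr]
        rcases h3 : lowestEmpty (fun x => M (addr b.1 x)) (fun x => M (addr b.2 x)) with _ | ⟨_ | _, x⟩
        · exact .extend hr hno fun x => lowestEmpty_eq_none h3 x
        · obtain ⟨h4, h5⟩ := lowestEmpty_eq_some h3
          simp only [Option.map_some, Option.getD_some, Option.map_none, Option.getD_none,
            writeBucket_update]
          exact .fill (addr b.1 x) h4 (.inl rfl) hr hno h5
        · obtain ⟨h4, h5⟩ := lowestEmpty_eq_some h3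
          simp only [Option.map_some, Option.getD_some, Option.map_none, Option.getD_none,
            writeBucket_update]
          exact .fill (addr b.2 x) h4 (.inr rfl) hr hno h5
    · obtain ⟨v₀, hv₀⟩ := findKey_eq_some h2
      simp only [Option.map_some, Option.getD_some, Option.map_none, Option.getD_none,
        writeBucket_update]
      exact .update _ v₀ hv₀
  · obtain ⟨v₀, hv₀⟩ := findKey_eq_some h1
    simp only [Option.map_some, Option.getD_some, Option.map_none, Option.getD_none,
      writeBucket_update]
    exact .update _ v₀ hv₀

theorem Implements.storeIn {c : U → Bucket n × Bucket n} {M : Addr n t → Block U V}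
    {root : List (U × V)} {m : U → Option V} (h : Implements c M root m) (u : U) (v : V) :
    Implements c (storeIn (c u) u v M root).1 (storeIn (c u) u v M root).2
      (Function.update m u (some v)) := by
  have hc := storeCase_storeIn (c u) u v M root
  generalize DPKVS.storeIn (c u) u v M root = r at hc
  -- Covers both writes into the tree: the target slot already holds `u`, or it is empty and `u` is
  -- stored nowhere.
  have upd : ∀ a : Addr n t, OnPath (c u) a → u ∉ root.map Prod.fst →
      (∀ a' v', M a' = some (u, v') → a' = a) → (∀ u' v', M a = some (u', v') → u' = u) →
      Implements c (Function.update M a (some (u, v))) root (Function.update m u (some v)) := by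
    intro a hp hr hother ha
    constructor
    · intro a' u' v' h'
      by_cases haa : a' = a
      · subst haa
        simp only [Function.update_self, Option.some.injEq, Prod.mk.injEq] at h'
        obtain ⟨rfl, rfl⟩ := h'
        exact ⟨by simp, hp⟩
      · rw [Function.update_of_ne haa] at h'
        have hu : u' ≠ u := by rintro rfl; exact haa (hother _ _ h')
        rw [Function.update_of_ne hu]
        exact h.mem a' u' v' h'
    · intro e he
      have : e.1 ≠ u := by rintro rfl; exact hr (List.mem_map_of_mem he)
      rw [Function.update_of_ne this]
      exact h.inRoot e he
    · intro u' v' h'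
      by_cases hu : u' = u
      · subst hu
        simp only [Function.update_self, Option.some.injEq] at h'
        exact .inl ⟨a, by simp [h']⟩
      · rw [Function.update_of_ne hu] at h'
        rcases h.complete u' v' h' with ⟨a', ha'⟩ | h''
        · refine .inl ⟨a', ?_⟩
          rwa [Function.update_of_ne]
          rintro rfl
          exact hu (ha _ _ ha')
        · exact .inr h''
    · intro a₁ a₂ u' v₁ v₂ h₁ h₂
      by_cases h1 : a₁ = a <;> by_cases h2 : a₂ = a
      · rw [h1, h2]
      · subst h1
        rw [Function.update_of_ne h2] at h₂
        simp only [Function.update_self, Option.some.injEq, Prod.mk.injEq] at h₁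
        exact (hother a₂ v₂ (h₁.1 ▸ h₂)).symm
      · subst h2
        rw [Function.update_of_ne h1] at h₁
        simp only [Function.update_self, Option.some.injEq, Prod.mk.injEq] at h₂
        exact hother a₁ v₁ (h₂.1 ▸ h₁)
      · rw [Function.update_of_ne h1] at h₁
        rw [Function.update_of_ne h2] at h₂
        exact h.unique _ _ _ _ _ h₁ h₂
    · intro a' u' v' h'
      by_cases haa : a' = a
      · subst haa
        simp only [Function.update_self, Option.some.injEq, Prod.mk.injEq] at h'
        exact h'.1 ▸ hr
      · rw [Function.update_of_ne haa] at h'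
        exact h.disjoint _ _ _ h'
  cases hc with
  | update a v₀ ha =>
    refine upd a (h.mem _ _ _ ha).2 (h.disjoint _ _ _ ha) (fun a' v' h' => h.unique _ _ _ _ _ h' ha)
      fun u' v' h' => ?_
    rw [ha] at h'
    simp only [Option.some.injEq, Prod.mk.injEq] at h'
    exact h'.1.symm
  | updateRoot hr =>
    have hM : ∀ a v', M a ≠ some (u, v') := fun a v' h' => h.disjoint _ _ _ h' hr
    have hfst : (root.map fun e => if e.1 = u then (u, v) else e).map Prod.fst
        = root.map Prod.fst := by
      rw [List.map_map]
      refine List.map_congr_left fun e _ => ?_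
      simp only [Function.comp]
      split_ifs with he
      · exact he.symm
      · rfl
    constructor
    · intro a u' v' h'
      have hu : u' ≠ u := by rintro rfl; exact hM _ _ h'
      rw [Function.update_of_ne hu]
      exact h.mem a u' v' h'
    · intro e he
      obtain ⟨e', he', rfl⟩ := List.mem_map.1 he
      split_ifs with hu
      · simp
      · rw [Function.update_of_ne hu]
        exact h.inRoot e' he'
    · intro u' v' h'
      by_cases hu : u' = u
      · subst hu
        simp only [Function.update_self, Option.some.injEq] at h'
        subst h'
        obtain ⟨e, he, heu⟩ := List.mem_map.1 hr
        exact .inr (List.mem_map.2 ⟨e, he, by simp [heu]⟩)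
      · rw [Function.update_of_ne hu] at h'
        exact (h.complete u' v' h').imp_right fun h'' => List.mem_map.2 ⟨_, h'', by simp [hu]⟩
    · exact h.unique
    · intro a u' v' h'
      rw [hfst]
      exact h.disjoint a u' v' h'
  | fill a ha hp hr hno _ =>
    refine upd a hp hr (fun a' v' h' => absurd h' (hno a' (h.mem _ _ _ h').2 v')) ?_
    intro u' v' h'
    simp [ha] at h'
  | extend hr hno _ =>
    have hm := h.not_mem_of_none hr hno
    have hne : ∀ u' v', m u' = some v' → u' ≠ u := by
      rintro u' v' h' rfl
      simp [hm] at h'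
    constructor
    · intro a u' v' h'
      have h1 := h.mem a u' v' h'
      rwa [Function.update_of_ne (hne _ _ h1.1)]
    · intro e he
      rcases List.mem_append.1 he with he | he
      · have h1 := h.inRoot e he
        rwa [Function.update_of_ne (hne _ _ h1)]
      · rw [List.mem_singleton] at he
        simp [he]
    · intro u' v' h'
      by_cases hu : u' = u
      · subst hu
        simp only [Function.update_self, Option.some.injEq] at h'
        exact .inr (by simp [h'])
      · rw [Function.update_of_ne hu] at h'
        exact (h.complete u' v' h').imp_right fun h'' => List.mem_append_left _ h''
    · exact h.unique
    · intro a u' v' h'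
      have h1 := h.mem a u' v' h'
      simp only [List.map_append, List.mem_append, not_or]
      exact ⟨h.disjoint a u' v' h', by simpa using hne _ _ h1.1⟩

theorem Implements.retrieve {c : U → Bucket n × Bucket n} {M : Addr n t → Block U V}
    {root : List (U × V)} {m : U → Option V} (h : Implements c M root m) (u : U) :
    retrieve u (fun x => M (addr (c u).1 x)) (fun x => M (addr (c u).2 x)) root = m u := by
  unfold DPKVS.retrieve
  rcases h1 : findKey u (fun x => M (addr (c u).1 x)) with _ | x
  · rcases h2 : findKey u (fun x => M (addr (c u).2 x)) with _ | x
    · have hno : ∀ a', OnPath (c u) a' → ∀ v, M a' ≠ some (u, v) := by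
        intro a' ha' v
        rcases ha'.exists_pos with h | h <;> rw [h]
        · exact findKey_eq_none h1 _ v
        · exact findKey_eq_none h2 _ v
      simp only
      rcases hf : root.find? (fun e => e.1 = u) with _ | e
      · rw [h.not_mem_of_none _ hno]
        · rw [hf]; rfl
        · rw [List.find?_eq_none] at hf
          intro hr
          obtain ⟨e, he, heu⟩ := List.mem_map.1 hr
          exact hf e he (by simpa using heu)
      · have h3 := h.inRoot e (List.mem_of_find?_eq_some hf)
        have h4 : e.1 = u := by simpa using List.find?_some hf
        rw [hf, Option.map_some, ← h4, h3]
    · obtain ⟨v, hv⟩ := findKey_eq_some h2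
      simp [hv, (h.mem _ _ _ hv).1]
  · obtain ⟨v, hv⟩ := findKey_eq_some h1
    simp [hv, (h.mem _ _ _ hv).1]

end Storing

/-! ### A query as a deterministic function of its randomness -/

section Query

variable {n t : ℕ} {U V : Type}

/-- The stash after a RAM query to bucket `i`. -/
def stashNext (S : Finset (Bucket n)) (i : Bucket n) (m : Bool) : Finset (Bucket n) :=
  if m then insert i S else S.erase i

theorem mem_secondBucket {b : Bucket n × Bucket n} {b₂ : Bucket n}
    (h : b₂ ∈ (secondBucket b).support) (hb : b.2 ≠ b.1) : b₂ = b.2 := by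
  simpa [secondBucket, hb] using h

variable [DecidableEq U]

/-- The answer, the memory, and the super root after a query. -/
def memQuery (b : Bucket n × Bucket n) (q : Query U V) (M : Addr n t → Block U V)
    (root : List (U × V)) : Option V × (Addr n t → Block U V) × List (U × V) :=
  match q.2 with
  | .read => (retrieve q.1 (fun x => M (addr b.1 x)) (fun x => M (addr b.2 x)) root, M, root)
  | .write v => (none, storeIn b q.1 v M root)

/-- A query of the key-value storage as a function of its randomness. -/
def kvsStep (s : State n t U V) (q : Query U V) (b₂ : Bucket n)
    (ω₁ ω₂ ω₃ ω₄ : Bucket n × Bucket n × Bool) : StepLog n t V × State n t U V :=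
  let b₁ := (s.choices q.1).1
  let B₁ := ramContent s b₁
  let s₁ := ramNext s b₁ none ω₁.2.2
  let B₂ := if (s.choices q.1).2 = b₁ then B₁ else ramContent s₁ b₂
  let s₂ := ramNext s₁ b₂ none ω₂.2.2
  let r : Option V × List (U × V) × Option (Content n t U V) × Option (Content n t U V) :=
    match q.2 with
    | .read => (retrieve q.1 B₁ B₂ s₂.superRoot, s₂.superRoot, none, none)
    | .write v => (none, store q.1 v B₁ B₂ s₂.superRoot)
  let s₃ := ramNext { s₂ with superRoot := r.2.1 } b₁ r.2.2.1 ω₃.2.2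
  let s₄ := ramNext s₃ b₂ r.2.2.2 ω₄.2.2
  (⟨r.1, ramTransfers t ω₁.1 ω₁.2.1 ++ ramTransfers t ω₂.1 ω₂.2.1 ++ ramTransfers t ω₃.1 ω₃.2.1
      ++ ramTransfers t ω₄.1 ω₄.2.1,
    [s₁.clientBlocks, s₂.clientBlocks, s₃.clientBlocks, s₄.clientBlocks]⟩, s₄)

/-- The only randomness is the padding bucket and four noises, each governed by the current set of
stashed buckets alone; everything else is the function `kvsStep`. -/
theorem kvsQuery_eq [NeZero n] (C : ℕ) (s : State n t U V) (q : Query U V) :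
    kvsQuery C s q =
      (secondBucket (s.choices q.1)).bind fun b₂ =>
        let b₁ := (s.choices q.1).1
        (ramNoise C b₁ (decide (b₁ ∈ s.stashed))).bind fun ω₁ =>
          let S₁ := stashNext s.stashed b₁ ω₁.2.2
          (ramNoise C b₂ (decide (b₂ ∈ S₁))).bind fun ω₂ =>
            let S₂ := stashNext S₁ b₂ ω₂.2.2
            (ramNoise C b₁ (decide (b₁ ∈ S₂))).bind fun ω₃ =>
              let S₃ := stashNext S₂ b₁ ω₃.2.2
              (ramNoise C b₂ (decide (b₂ ∈ S₃))).bind fun ω₄ =>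
                PMF.pure (kvsStep s q b₂ ω₁ ω₂ ω₃ ω₄) := by
  have h0 : ∀ {α β : Type} (p : PMF α) (f : α → PMF β), (p >>= f) = p.bind f := fun _ _ => rfl
  have h1 : ∀ {α : Type} (a : α), (pure a : PMF α) = PMF.pure a := fun _ => rfl
  have h2 : ∀ (s : State n t U V) (root : List (U × V)),
    State.stashed { s with superRoot := root } = s.stashed := fun _ _ => rfl
  obtain ⟨u, _ | v⟩ := q
  all_goals
    simp only [kvsQuery, h0, h1, ramQuery_eq, PMF.bind_map, Function.comp_def, stashed_ramNext,
      stashNext, kvsStep, Option.getD_none, h2]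

/-- The effect of a query on a state that represents a memory. -/
theorem kvsStep_spec {s : State n t U V} {M : Addr n t → Block U V} (h : s.Represents M)
    (q : Query U V) {b₂ : Bucket n}
    (hb : (s.choices q.1).2 ≠ (s.choices q.1).1 → b₂ = (s.choices q.1).2)
    (ω₁ ω₂ ω₃ ω₄ : Bucket n × Bucket n × Bool) :
    let r := memQuery (s.choices q.1) q M s.superRoot
    let x := kvsStep s q b₂ ω₁ ω₂ ω₃ ω₄
    let S₁ := stashNext s.stashed (s.choices q.1).1 ω₁.2.2
    let S₂ := stashNext S₁ b₂ ω₂.2.2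
    let S₃ := stashNext S₂ (s.choices q.1).1 ω₃.2.2
    let S₄ := stashNext S₃ b₂ ω₄.2.2
    x.1.answer = r.1 ∧ x.2.Represents r.2.1 ∧ x.2.superRoot = r.2.2 ∧ x.2.choices = s.choices ∧
      x.2.stashed = S₄ ∧
      x.1.clientSizes = [S₁.card * Fintype.card (Pos n t) + s.superRoot.length,
        S₂.card * Fintype.card (Pos n t) + s.superRoot.length,
        S₃.card * Fintype.card (Pos n t) + r.2.2.length,
        S₄.card * Fintype.card (Pos n t) + r.2.2.length] := by
  have hcb : ∀ s : State n t U V,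
    s.clientBlocks = s.stashed.card * Fintype.card (Pos n t) + s.superRoot.length := fun _ => rfl
  have h2 : ∀ (s : State n t U V) (root : List (U × V)),
    State.stashed { s with superRoot := root } = s.stashed := fun _ _ => rfl
  obtain ⟨u, op⟩ := q
  have r1 := h.ramNext (s.choices u).1 none ω₁.2.2
  have r2 := r1.ramNext b₂ none ω₂.2.2
  simp only [Option.map_none, Option.getD_none] at r1 r2
  have r2' : ∀ root, State.Represents
      { ramNext (ramNext s (s.choices u).1 none ω₁.2.2) b₂ none ω₂.2.2 with superRoot := root } M :=
    fun root => ⟨r2.stash, r2.server⟩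
  -- If the choices coincide, the padding content is discarded and the first content is used twice;
  -- otherwise `b₂` is the second choice.
  have hB : (if (s.choices u).2 = (s.choices u).1 then fun x => M (addr (s.choices u).1 x)
      else fun x => M (addr b₂ x)) = fun x => M (addr (s.choices u).2 x) := by
    split_ifs with hc
    · rw [hc]
    · rw [hb hc]
  cases op with
  | read =>
    have r4 := ((r2' s.superRoot).ramNext (s.choices u).1 none ω₃.2.2).ramNext b₂ none ω₄.2.2
    simp only [Option.map_none, Option.getD_none] at r4
    simp only [kvsStep, memQuery, hcb, stashed_ramNext, superRoot_ramNext,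
      h.ramContent, r1.ramContent, hB, h2, stashNext]
    exact ⟨trivial, r4, trivial, by simp, trivial, trivial⟩
  | write v =>
    simp only [kvsStep, memQuery, hcb, stashed_ramNext, superRoot_ramNext,
      h.ramContent, r1.ramContent, hB, h2, stashNext]
    refine ⟨trivial, ?_, rfl, by simp, trivial, rfl⟩
    set st := store u v (fun x => M (addr (s.choices u).1 x)) (fun x => M (addr (s.choices u).2 x))
      s.superRoot with hst
    have r4 := ((r2' st.1).ramNext (s.choices u).1 st.2.1 ω₃.2.2).ramNext b₂ st.2.2 ω₄.2.2
    have : (storeIn (s.choices u) u v M s.superRoot).1 =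
        (st.2.2.map (writeBucket ((st.2.1.map (writeBucket M (s.choices u).1)).getD M) b₂)).getD
          ((st.2.1.map (writeBucket M (s.choices u).1)).getD M) := by
      unfold storeIn
      simp only [← hst]
      -- With coinciding choices `b₂` is arbitrary, but then nothing is written to it.
      by_cases hc : (s.choices u).2 = (s.choices u).1
      · have hn : st.2.2 = none := by rw [hst, hc, store_same_snd]
        rw [hn, Option.map_none, Option.map_none]
      · rw [hb hc]
    rw [this]
    exact r4

end Query

/-! ### Correctness -/

section Correctness

variable {n t : ℕ} {U V : Type}

theorem length_moveBucket (dir : Direction) (b : Bucket n) :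
    (moveBucket t dir b).length = (treeHeight n + 1) * t := by
  simp [moveBucket, List.length_flatMap]

theorem length_ramTransfers (d o : Bucket n) :
    (ramTransfers t d o).length = 3 * ((treeHeight n + 1) * t) := by
  simp only [ramTransfers, List.length_append, length_moveBucket]
  ring

/-- Put the buckets of `S` into the empty stash. -/
def State.withStash (s : State n t U V) (S : Finset (Bucket n)) : State n t U V :=
  { s with stash := fun b => if b ∈ S then some (fun x => s.server (addr b x)) else none }

theorem represents_withStash (s : State n t U V) (S : Finset (Bucket n)) :
    (s.withStash S).Represents s.server := by
  constructor
  · intro c B h x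
    simp only [State.withStash, Option.ite_none_right_eq_some, Option.some.injEq] at h
    rw [← h.2]
  · intro a _
    rfl

@[simp] theorem stashed_withStash (s : State n t U V) (S : Finset (Bucket n)) :
    (s.withStash S).stashed = S := by
  ext b
  by_cases h : b ∈ S <;> simp [mem_stashed, State.withStash, h]

/-- The buckets that a function of draws puts into the stash. -/
def drawnStash (C : ℕ) (r : Bucket n → Bucket n) : Finset (Bucket n) :=
  Finset.univ.filter fun b => (r b : ℕ) < C

theorem clientBlocks_withStash (s : State n t U V) (S : Finset (Bucket n)) :
    (s.withStash S).clientBlocks = S.card * Fintype.card (Pos n t) + s.superRoot.length := by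
  have h : ∀ s : State n t U V,
    s.clientBlocks = s.stashed.card * Fintype.card (Pos n t) + s.superRoot.length := fun _ => rfl
  rw [h, stashed_withStash]
  rfl

variable [DecidableEq U]

/-- The state that stores a list of items, with nothing stashed. -/
def storeAll (t : ℕ) (c : U → Bucket n × Bucket n) (D : List (U × V)) : State n t U V :=
  D.foldl initStore ⟨c, fun _ => none, [], fun _ => none⟩

theorem storeAll_concat (c : U → Bucket n × Bucket n) (D : List (U × V)) (e : U × V) :
    storeAll t c (D ++ [e]) = initStore (storeAll t c D) e := by
  simp [storeAll]

@[simp] theorem choices_storeAll (c : U → Bucket n × Bucket n) (D : List (U × V)) :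
    (storeAll t c D).choices = c := by
  induction D using List.reverseRecOn with
  | nil => rfl
  | append_singleton D e ih => rw [storeAll_concat, initStore_eq, ih]

theorem implements_storeAll (c : U → Bucket n × Bucket n) (D : List (U × V)) :
    Implements c (storeAll t c D).server (storeAll t c D).superRoot (initialDict D) := by
  induction D using List.reverseRecOn with
  | nil => constructor <;> simp [storeAll, initialDict]
  | append_singleton D e ih =>
    have h1 : initialDict (D ++ [e]) = Function.update (initialDict D) e.1 (some e.2) := by
      simp [initialDict]
    rw [storeAll_concat, initStore_eq, h1, choices_storeAll]
    exact ih.storeIn e.1 e.2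

variable [NeZero n]

theorem support_kvsQuery {C : ℕ} {s : State n t U V} {q : Query U V}
    {x : StepLog n t V × State n t U V} (hx : x ∈ (kvsQuery C s q).support) :
    ∃ b₂ ω₁ ω₂ ω₃ ω₄, ((s.choices q.1).2 ≠ (s.choices q.1).1 → b₂ = (s.choices q.1).2) ∧
      x = kvsStep s q b₂ ω₁ ω₂ ω₃ ω₄ := by
  rw [kvsQuery_eq] at hx
  simp only [PMF.mem_support_bind_iff, PMF.mem_support_pure_iff] at hx
  obtain ⟨b₂, hb₂, ω₁, -, ω₂, -, ω₃, -, ω₄, -, rfl⟩ := hx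
  exact ⟨b₂, ω₁, ω₂, ω₃, ω₄, mem_secondBucket hb₂, rfl⟩

theorem runQueries_cons (C : ℕ) (q : Query U V) (Q : List (Query U V)) (s : State n t U V) :
    runQueries C (q :: Q) s = (kvsQuery C s q).bind fun x =>
      (runQueries C Q x.2).map fun l => x.1 :: l := rfl

/-- Both invariants are carried through the induction. The factor 12 counts four RAM queries with
three bucket movements each. -/
theorem runQueries_correct (C : ℕ) (Q : List (Query U V)) :
    ∀ (s : State n t U V) (M : Addr n t → Block U V) (m : U → Option V), s.Represents M →
      Implements s.choices M s.superRoot m → ∀ l ∈ (runQueries C Q s).support,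
        l.map StepLog.answer = idealAnswers Q m ∧
          ∀ T ∈ l.map StepLog.transfers, T.length = 12 * ((treeHeight n + 1) * t) := by
  induction Q with
  | nil =>
    intro s M m _ _ l hl
    rw [runQueries, PMF.mem_support_pure_iff] at hl
    subst hl
    simp [idealAnswers]
  | cons q Q ih =>
    intro s M m hM hm l hl
    rw [runQueries_cons] at hl
    simp only [PMF.mem_support_bind_iff, PMF.mem_support_map_iff] at hl
    obtain ⟨x, hx, l', hl', rfl⟩ := hl
    obtain ⟨b₂, ω₁, ω₂, ω₃, ω₄, hb, rfl⟩ := support_kvsQuery hx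
    obtain ⟨h1, h2, h3, h4, -⟩ := kvsStep_spec hM q hb ω₁ ω₂ ω₃ ω₄
    have hlen : (kvsStep s q b₂ ω₁ ω₂ ω₃ ω₄).1.transfers.length =
        12 * ((treeHeight n + 1) * t) := by
      simp only [kvsStep, List.length_append, length_ramTransfers]
      ring
    generalize kvsStep s q b₂ ω₁ ω₂ ω₃ ω₄ = x at *
    simp only [List.map_cons, List.forall_mem_cons]
    obtain ⟨u, _ | v⟩ := q
    · have := ih x.2 _ m h2 (by rw [h3, h4]; exact hm) l' hl'
      rw [idealAnswers, this.1, h1, memQuery]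
      refine ⟨congrArg (· :: _) (hm.retrieve u), hlen, this.2⟩
    · have := ih x.2 _ (Function.update m u (some v)) h2
        (by rw [h3, h4]; exact hm.storeIn u v) l' hl'
      rw [idealAnswers, this.1, h1]
      exact ⟨rfl, hlen, this.2⟩

theorem execute_eq [Fintype U] (C : ℕ) (D : List (U × V)) (Q : List (Query U V)) :
    execute n t C D Q =
      (PMF.uniformOfFintype (U → Bucket n × Bucket n)).bind fun c =>
        (PMF.uniformOfFintype (Bucket n → Bucket n)).bind fun r =>
          let s := (storeAll t c D).withStash (drawnStash C r)
          (runQueries C Q s).map fun l => ⟨s.clientBlocks, l⟩ := by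
  have h0 : ∀ {α β : Type} (p : PMF α) (f : α → PMF β), (p >>= f) = p.bind f := fun _ _ => rfl
  have h1 : ∀ {α : Type} (a : α), (pure a : PMF α) = PMF.pure a := fun _ => rfl
  simp only [execute, setup, h0, h1, PMF.bind_bind, PMF.pure_bind]
  simp only [State.withStash, drawnStash, Finset.mem_filter, Finset.mem_univ, true_and]
  rfl

theorem execute_correct [Fintype U] (C : ℕ) (D : List (U × V)) (Q : List (Query U V))
    {e : Execution n t V} (he : e ∈ (execute n t C D Q).support) :
    e.answers = idealAnswers Q (initialDict D) ∧
      ∀ T ∈ e.view, T.length = 12 * ((treeHeight n + 1) * t) := by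
  rw [execute_eq] at he
  simp only [PMF.mem_support_bind_iff, PMF.mem_support_map_iff] at he
  obtain ⟨c, -, r, -, l, hl, rfl⟩ := he
  refine runQueries_correct C Q _ _ _ (represents_withStash _ _) ?_ l hl
  have h : ((storeAll t c D).withStash (drawnStash C r)).choices = c := choices_storeAll c D
  rw [h]
  exact implements_storeAll c D

end Correctness

/-! ### The view of the server as a hidden Markov process on the set of stashed buckets -/

section Markov

open scoped ENNReal

variable {n : ℕ} {M : ℝ≥0∞}

theorem insert_erase_eq_insert (S : Finset (Bucket n)) (i : Bucket n) :
    insert i (S.erase i) = insert i S := by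
  grind

/-- Pairs each set avoiding `i` with the same set plus `i`; a query to `i` only moves mass inside
such a pair. -/
theorem sum_finset_eq (i : Bucket n) (f : Finset (Bucket n) → ℝ≥0∞) :
    ∑ S, f S = ∑ S ∈ (Finset.univ.erase i).powerset, (f S + f (insert i S)) := by
  rw [Finset.sum_add_distrib, ← Finset.sum_powerset_insert (Finset.notMem_erase i _),
    Finset.insert_erase (Finset.mem_univ i), Finset.powerset_univ]

/-- Inserting `i` is an at most two-to-one map on sets. -/
theorem sum_insert_le (i : Bucket n) (g : Finset (Bucket n) → ℝ≥0∞) :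
    ∑ S, g (insert i S) ≤ 2 * ∑ S, g S := by
  rw [sum_finset_eq i, sum_finset_eq i, Finset.mul_sum]
  refine Finset.sum_le_sum fun S _ => ?_
  rw [Finset.insert_idem, mul_add, two_mul (g (insert i S))]
  exact le_add_self

/-- Adding a bucket to the stash decreases `f` at most by a factor `M`. -/
def Upward (M : ℝ≥0∞) (f : Finset (Bucket n) → ℝ≥0∞) : Prop :=
  ∀ S i, f (S.erase i) ≤ M * f (insert i S)

theorem Upward.le_insert {f : Finset (Bucket n) → ℝ≥0∞} (hf : Upward M f) (h1 : 1 ≤ M)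
    (S : Finset (Bucket n)) (i : Bucket n) : f S ≤ M * f (insert i S) := by
  by_cases hi : i ∈ S
  · rw [Finset.insert_eq_of_mem hi]
    exact le_mul_of_one_le_left' h1
  · have := hf S i
    rwa [Finset.erase_eq_of_notMem hi] at this

theorem Upward.sum {ι : Type} {s : Finset ι} {f : ι → Finset (Bucket n) → ℝ≥0∞}
    (hf : ∀ j, Upward M (f j)) : Upward M fun S => ∑ j ∈ s, f j S := by
  intro S i
  rw [Finset.mul_sum]
  exact Finset.sum_le_sum fun j _ => hf j S i

theorem drawnStash_update (C : ℕ) (r : Bucket n → Bucket n) (i x : Bucket n) :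
    drawnStash C (Function.update r i x) =
      if (x : ℕ) < C then insert i (drawnStash C r) else (drawnStash C r).erase i := by
  ext j
  by_cases hj : j = i
  · subst hj
    split_ifs with h <;> simp [drawnStash, h]
  · split_ifs <;> simp [drawnStash, hj]

variable [NeZero n]

/-- The probability that a bucket is put into the stash. -/
noncomputable def stashProb (n : ℕ) [NeZero n] (C : ℕ) : ℝ≥0∞ :=
  expect (PMF.uniformOfFintype (Bucket n)) fun r => if (r : ℕ) < C then 1 else 0

/-- The probability that a bucket is not put into the stash. -/
noncomputable def skipProb (n : ℕ) [NeZero n] (C : ℕ) : ℝ≥0∞ :=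
  expect (PMF.uniformOfFintype (Bucket n)) fun r => if (r : ℕ) < C then 0 else 1

theorem expect_lt_ite (C : ℕ) (x y : ℝ≥0∞) :
    expect (PMF.uniformOfFintype (Bucket n)) (fun r => if (r : ℕ) < C then x else y) =
      stashProb n C * x + skipProb n C * y := by
  rw [stashProb, skipProb, ← expect_mul_const, ← expect_mul_const, ← expect_add]
  congr 1
  funext r
  split_ifs <;> simp

theorem stashProb_add_skipProb (C : ℕ) : stashProb n C + skipProb n C = 1 := by
  have := expect_lt_ite (n := n) C 1 1
  simpa [expect_const] using this.symm

theorem stashProb_le_one (C : ℕ) : stashProb n C ≤ 1 :=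
  stashProb_add_skipProb (n := n) C ▸ le_self_add

theorem skipProb_le_one (C : ℕ) : skipProb n C ≤ 1 :=
  stashProb_add_skipProb (n := n) C ▸ le_add_self

/-- The probability to download bucket `d` in a query to bucket `i`, which is stashed if `m`. -/
noncomputable def downWeight (m : Bool) (i d : Bucket n) : ℝ≥0∞ :=
  if m then (numBuckets n : ℝ≥0∞)⁻¹ else if d = i then 1 else 0

/-- The probability to put bucket `i` into the stash or not and to overwrite bucket `o`. -/
noncomputable def upWeight (C : ℕ) (m : Bool) (i o : Bucket n) : ℝ≥0∞ :=
  if m then stashProb n C * (numBuckets n : ℝ≥0∞)⁻¹ else if o = i then skipProb n C else 0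

theorem numBuckets_ne_zero : (numBuckets n : ℝ≥0∞) ≠ 0 :=
  Nat.cast_ne_zero.2 (NeZero.ne _)

theorem one_le_numBuckets : (1 : ℝ≥0∞) ≤ numBuckets n :=
  Nat.one_le_cast.2 (Nat.one_le_iff_ne_zero.2 (NeZero.ne _))

theorem downWeight_le_one (m : Bool) (i d : Bucket n) : downWeight m i d ≤ 1 := by
  unfold downWeight
  split_ifs
  · exact ENNReal.inv_le_one.2 one_le_numBuckets
  · exact le_rfl
  · exact zero_le_one

theorem upWeight_le_one (C : ℕ) (m : Bool) (i d : Bucket n) : upWeight C m i d ≤ 1 := by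
  unfold upWeight
  split_ifs
  · exact mul_le_one' (stashProb_le_one C) (ENNReal.inv_le_one.2 one_le_numBuckets)
  · exact skipProb_le_one C
  · simp

/-- The law factors: the download depends only on whether `i` was stashed before the query, and the
overwritten bucket only on whether it is stashed afterwards. This symmetry allows the chain to be
read backwards in time. -/
theorem expect_ramNoise (C : ℕ) (i : Bucket n) (m : Bool)
    (f : Bucket n × Bucket n × Bool → ℝ≥0∞) :
    expect (ramNoise C i m) f =
      ∑ d, ∑ o, downWeight m i d *
        (upWeight C true i o * f (d, o, true) + upWeight C false i o * f (d, o, false)) := by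
  have hup : ∀ d, expect ((PMF.uniformOfFintype (Bucket n)).bind fun r =>
      if (r : ℕ) < C then (PMF.uniformOfFintype (Bucket n)).map fun o => (d, o, true)
      else PMF.pure (d, i, false)) f =
      ∑ o, (upWeight C true i o * f (d, o, true) + upWeight C false i o * f (d, o, false)) := by
    intro d
    simp only [expect_bind, apply_ite (fun p => expect p f), expect_map, expect_pure,
      expect_lt_ite, Finset.sum_add_distrib]
    congr 1
    · simp [expect_uniform, upWeight, mul_assoc, Finset.mul_sum]
    · simp [upWeight]
  rw [ramNoise, expect_bind]
  simp only [hup, ← Finset.mul_sum]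
  cases m
  · simp [downWeight, expect_pure]
  · simp [downWeight, expect_uniform, Finset.mul_sum]

/-- The expectation of a function of what the server sees in queries to a list of buckets, given the
set of stashed buckets. -/
noncomputable def runExpect (C : ℕ) :
    List (Bucket n) → (List (Bucket n × Bucket n) → ℝ≥0∞) → Finset (Bucket n) → ℝ≥0∞
  | [], F, _ => F []
  | i :: is, F, S => expect (ramNoise C i (decide (i ∈ S))) fun ω =>
      runExpect C is (fun l => F ((ω.1, ω.2.1) :: l)) (stashNext S i ω.2.2)

/-- The expectation of `W` of the next set of stashed buckets on the event that `d` and `o` are seen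
in a query to `i`. -/
noncomputable def backward (C : ℕ) (i d o : Bucket n) (W : Finset (Bucket n) → ℝ≥0∞)
    (S : Finset (Bucket n)) : ℝ≥0∞ :=
  downWeight (decide (i ∈ S)) i d *
    (upWeight C true i o * W (insert i S) + upWeight C false i o * W (S.erase i))

/-- The weights of the next sets of stashed buckets on the event that `d` and `o` are seen in a
query to `i`. -/
noncomputable def forward (C : ℕ) (i d o : Bucket n) (α : Finset (Bucket n) → ℝ≥0∞)
    (S : Finset (Bucket n)) : ℝ≥0∞ :=
  upWeight C (decide (i ∈ S)) i o *
    (downWeight true i d * α (insert i S) + downWeight false i d * α (S.erase i))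

theorem runExpect_cons (C : ℕ) (i : Bucket n) (is : List (Bucket n))
    (F : List (Bucket n × Bucket n) → ℝ≥0∞) (S : Finset (Bucket n)) :
    runExpect C (i :: is) F S =
      ∑ d, ∑ o, backward C i d o (runExpect C is fun l => F ((d, o) :: l)) S := by
  rw [runExpect, expect_ramNoise]
  rfl

/-- `forward` and `backward` are adjoint: both sides sum the same transition weights over
consecutive sets that agree outside `i`. -/
theorem sum_backward (C : ℕ) (i d o : Bucket n) (α W : Finset (Bucket n) → ℝ≥0∞) :
    ∑ S, α S * backward C i d o W S = ∑ S, forward C i d o α S * W S := by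
  rw [sum_finset_eq i, sum_finset_eq i]
  refine Finset.sum_congr rfl fun S hS => ?_
  have hi : i ∉ S := fun h => by simpa using Finset.mem_powerset.1 hS h
  simp only [backward, forward, hi, Finset.mem_insert_self, Finset.insert_idem,
    Finset.erase_insert hi, Finset.erase_eq_of_notMem hi, decide_true, decide_false]
  ring

/-- Toggling `i` itself changes only the download weight, which is at most 1 and equals `1 / b` when
`i` is stashed. Toggling another bucket leaves the weights alone, and the bound passes through from
`W`. -/
theorem Upward.backward {C : ℕ} {W : Finset (Bucket n) → ℝ≥0∞} (hW : Upward M W)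
    (hM : 1 ≤ M * (numBuckets n : ℝ≥0∞)⁻¹) (i d o : Bucket n) :
    Upward M (backward C i d o W) := by
  intro S j
  unfold DPKVS.backward
  by_cases hj : j = i
  · subst hj
    have h1 : downWeight (decide (j ∈ S.erase j)) j d ≤
        M * downWeight (decide (j ∈ insert j S)) j d := by
      refine (downWeight_le_one _ _ _).trans ?_
      simpa [downWeight] using hM
    simp only [insert_erase_eq_insert, Finset.erase_idem, Finset.insert_idem,
      Finset.erase_insert_eq_erase]
    rw [← mul_assoc]
    gcongr
  · have h1 : decide (i ∈ S.erase j) = decide (i ∈ insert j S) := by simp [Ne.symm hj]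
    have h2 : insert i (S.erase j) = (insert i S).erase j :=
      (Finset.erase_insert_of_ne (Ne.symm hj)).symm
    have h3 : (insert j S).erase i = insert j (S.erase i) := Finset.erase_insert_of_ne hj
    rw [h1, h2, Finset.insert_comm, h3, Finset.erase_right_comm]
    calc _ ≤ downWeight (decide (i ∈ insert j S)) i d *
          (upWeight C true i o * (M * W (insert j (insert i S))) +
            upWeight C false i o * (M * W (insert j (S.erase i)))) := by
          gcongr
          · exact hW _ _
          · exact hW _ _
      _ = _ := by ring

/-- The time reversal of `Upward.backward`: toggling `i` now changes only the overwrite weight,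
which is `p / b` when `i` is stashed afterwards. -/
theorem Upward.forward {C : ℕ} {α : Finset (Bucket n) → ℝ≥0∞} (hα : Upward M α)
    (hM : 1 ≤ M * (stashProb n C * (numBuckets n : ℝ≥0∞)⁻¹)) (i d o : Bucket n) :
    Upward M (forward C i d o α) := by
  intro S j
  unfold DPKVS.forward
  by_cases hj : j = i
  · subst hj
    have h1 : upWeight C (decide (j ∈ S.erase j)) j o ≤
        M * upWeight C (decide (j ∈ insert j S)) j o := by
      refine (upWeight_le_one _ _ _ _).trans ?_
      simpa [upWeight] using hM
    simp only [insert_erase_eq_insert, Finset.erase_idem, Finset.insert_idem,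
      Finset.erase_insert_eq_erase]
    rw [← mul_assoc]
    gcongr
  · have h1 : decide (i ∈ S.erase j) = decide (i ∈ insert j S) := by simp [Ne.symm hj]
    have h2 : insert i (S.erase j) = (insert i S).erase j :=
      (Finset.erase_insert_of_ne (Ne.symm hj)).symm
    have h3 : (insert j S).erase i = insert j (S.erase i) := Finset.erase_insert_of_ne hj
    rw [h1, h2, Finset.insert_comm, h3, Finset.erase_right_comm]
    calc _ ≤ upWeight C (decide (i ∈ insert j S)) i o *
          (downWeight true i d * (M * α (insert j (insert i S))) +
            downWeight false i d * (M * α (insert j (S.erase i)))) := by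
          gcongr
          · exact hα _ _
          · exact hα _ _
      _ = _ := by ring

theorem upward_runExpect (C : ℕ) (h1 : 1 ≤ M) (hM : 1 ≤ M * (numBuckets n : ℝ≥0∞)⁻¹)
    (is : List (Bucket n)) (F : List (Bucket n × Bucket n) → ℝ≥0∞) :
    Upward M (runExpect C is F) := by
  induction is generalizing F with
  | nil => exact fun S i => le_mul_of_one_le_left' h1
  | cons i is ih =>
    have : runExpect C (i :: is) F = fun S => ∑ d, ∑ o,
      DPKVS.backward C i d o (runExpect C is fun l => F ((d, o) :: l)) S :=
      funext fun S => runExpect_cons C i is F S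
    rw [this]
    exact Upward.sum fun d => Upward.sum fun o => (ih _).backward hM i d o

/-- Replacing the bucket of one query. -/
theorem sum_backward_le {C : ℕ} {α W : Finset (Bucket n) → ℝ≥0∞} (hα : Upward M α)
    (hW : Upward M W) (h1 : 1 ≤ M) (hM : 1 ≤ M * (numBuckets n : ℝ≥0∞)⁻¹)
    (hM' : 1 ≤ M * (stashProb n C * (numBuckets n : ℝ≥0∞)⁻¹)) (i i' d o : Bucket n) :
    ∑ S, α S * backward C i d o W S ≤ 8 * M ^ 6 * ∑ S, α S * backward C i' d o W S := by
  -- Compare `S` with `T = S ∪ {i, i'}`: two factors `M` to move `α`, two to move `W`, two for the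
  -- weights of `d` and `o` at `T`. The constant 2 comes from the two possible next sets.
  have key : ∀ S, α S * backward C i d o W S ≤ 2 * M ^ 6 *
      (α (insert i (insert i' S)) * backward C i' d o W (insert i (insert i' S))) := by
    intro S
    set T := insert i (insert i' S) with hT
    have hα' : α S ≤ M * (M * α T) :=
      (hα.le_insert h1 S i').trans (mul_le_mul_right (hα.le_insert h1 _ i) _)
    have hW1 : W (insert i S) ≤ M * W T := by
      have := hW.le_insert h1 (insert i S) i'
      rwa [Finset.insert_comm] at this
    have hW2 : W (S.erase i) ≤ M * (M * W T) := by
      refine (hW S i).trans (mul_le_mul_right hW1 _)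
    have hi : i' ∈ T := by simp [hT]
    -- With `i'` stashed before and after the query, `d` has weight `1 / b` and `o` has weight `p /
    -- b`, whatever `d` and `o` are.
    have hup : W T ≤ M * M * backward C i' d o W T := by
      have h2 : downWeight true i' d * (upWeight C true i' o * W T) ≤ backward C i' d o W T := by
        simp only [DPKVS.backward, hi, decide_true, Finset.insert_eq_of_mem hi]
        gcongr
        exact le_self_add
      calc W T = 1 * 1 * W T := by simp
        _ ≤ (M * (numBuckets n : ℝ≥0∞)⁻¹) *
            (M * (stashProb n C * (numBuckets n : ℝ≥0∞)⁻¹)) * W T := by gcongr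
        _ = M * M * (downWeight true i' d * (upWeight C true i' o * W T)) := by
          simp only [downWeight, upWeight, if_true]; ring
        _ ≤ _ := by gcongr
    have hB : backward C i d o W S ≤ 2 * (M * (M * W T)) := by
      calc backward C i d o W S ≤ 1 * (1 * W (insert i S) + 1 * W (S.erase i)) := by
            unfold DPKVS.backward
            gcongr
            · exact downWeight_le_one _ _ _
            · exact upWeight_le_one _ _ _ _
            · exact upWeight_le_one _ _ _ _
        _ ≤ 1 * (1 * (M * (M * W T)) + 1 * (M * (M * W T))) := by
            gcongr
            exact hW1.trans (le_mul_of_one_le_left' h1)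
        _ = _ := by ring
    calc α S * backward C i d o W S
        ≤ (M * (M * α T)) * (2 * (M * (M * (M * M * backward C i' d o W T)))) := by
          refine mul_le_mul' hα' (hB.trans ?_)
          gcongr
      _ = _ := by ring
  -- `S ↦ T` is a composition of two insertions, hence at most four-to-one.
  calc ∑ S, α S * backward C i d o W S
      ≤ ∑ S, (fun T => (fun R => 2 * M ^ 6 * (α R * backward C i' d o W R)) (insert i T))
          (insert i' S) := Finset.sum_le_sum fun S _ => key S
    _ ≤ 2 * ∑ T, (fun R => 2 * M ^ 6 * (α R * backward C i' d o W R)) (insert i T) :=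
        sum_insert_le _ _
    _ ≤ 2 * (2 * ∑ R, 2 * M ^ 6 * (α R * backward C i' d o W R)) := by
        gcongr
        exact sum_insert_le i fun R => 2 * M ^ 6 * (α R * backward C i' d o W R)
    _ = _ := by
        rw [← Finset.mul_sum]
        ring

/-- Queries before the changed one are absorbed into `α` by adjointness, which keeps it `Upward`;
those after it form `W`. The loss occurs once, independently of the number of queries. -/
theorem sum_runExpect_le {C : ℕ} (h1 : 1 ≤ M) (hM : 1 ≤ M * (numBuckets n : ℝ≥0∞)⁻¹)
    (hM' : 1 ≤ M * (stashProb n C * (numBuckets n : ℝ≥0∞)⁻¹)) (pre post : List (Bucket n))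
    (i i' : Bucket n) {α : Finset (Bucket n) → ℝ≥0∞} (hα : Upward M α)
    (F : List (Bucket n × Bucket n) → ℝ≥0∞) :
    ∑ S, α S * runExpect C (pre ++ i :: post) F S ≤
      8 * M ^ 6 * ∑ S, α S * runExpect C (pre ++ i' :: post) F S := by
  have expand : ∀ (α : Finset (Bucket n) → ℝ≥0∞) j is F, ∑ S, α S * runExpect C (j :: is) F S =
      ∑ d, ∑ o, ∑ S, α S * backward C j d o (runExpect C is fun l => F ((d, o) :: l)) S := by
    intro α j is F
    simp only [runExpect_cons, Finset.mul_sum]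
    rw [Finset.sum_comm]
    refine Finset.sum_congr rfl fun d _ => ?_
    rw [Finset.sum_comm]
  induction pre generalizing α F with
  | nil =>
    simp only [List.nil_append, expand]
    simp only [Finset.mul_sum (a := 8 * M ^ 6)]
    refine Finset.sum_le_sum fun d _ => Finset.sum_le_sum fun o _ => ?_
    rw [← Finset.mul_sum]
    exact sum_backward_le hα (upward_runExpect C h1 hM _ _) h1 hM hM' i i' d o
  | cons j pre ih =>
    simp only [List.cons_append, expand, sum_backward]
    simp only [Finset.mul_sum (a := 8 * M ^ 6)]
    refine Finset.sum_le_sum fun d _ => Finset.sum_le_sum fun o _ => ?_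
    rw [← Finset.mul_sum]
    exact ih (hα.forward hM' j d o) _

/-- Membership of `i` is redrawn independently of the other buckets. -/
theorem expect_drawnStash_resample (C : ℕ) (i : Bucket n) (g : Finset (Bucket n) → ℝ≥0∞) :
    expect (PMF.uniformOfFintype (Bucket n → Bucket n)) (fun r => g (drawnStash C r)) =
      expect (PMF.uniformOfFintype (Bucket n → Bucket n)) fun r =>
        stashProb n C * g (insert i (drawnStash C r)) +
          skipProb n C * g ((drawnStash C r).erase i) := by
  rw [expect_uniform_resample i]
  simp only [drawnStash_update, apply_ite g, expect_lt_ite]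

/-- The law of the initial set of stashed buckets. -/
noncomputable def stashLaw (C : ℕ) (S : Finset (Bucket n)) : ℝ≥0∞ :=
  expect (PMF.uniformOfFintype (Bucket n → Bucket n)) fun r => if drawnStash C r = S then 1 else 0

theorem expect_drawnStash (C : ℕ) (g : Finset (Bucket n) → ℝ≥0∞) :
    expect (PMF.uniformOfFintype (Bucket n → Bucket n)) (fun r => g (drawnStash C r)) =
      ∑ S, stashLaw C S * g S := by
  simp only [stashLaw, ← expect_mul_const, ← expect_sum]
  simp

/-- Removing or adding `i` compares `1 - p` with `p` times the same mass of the other buckets, and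
`1 - p ≤ 1 ≤ M * p`. -/
theorem upward_stashLaw {C : ℕ} (hM : 1 ≤ M * stashProb n C) :
    Upward M (stashLaw (n := n) C) := by
  intro S i
  have h1 : ∀ R : Finset (Bucket n), insert i R ≠ S.erase i := fun R h => by
    simpa [h] using Finset.mem_insert_self i R
  have h2 : ∀ R : Finset (Bucket n), R.erase i ≠ insert i S := fun R h => by
    simpa [← h] using Finset.mem_insert_self i S
  have h3 : ∀ R : Finset (Bucket n), R.erase i = S.erase i ↔ insert i R = insert i S := by
    intro R
    constructor <;> intro h
    · rw [← insert_erase_eq_insert, h, insert_erase_eq_insert]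
    · rw [← Finset.erase_insert_eq_erase, h, Finset.erase_insert_eq_erase]
  unfold stashLaw
  rw [expect_drawnStash_resample C i fun T => if T = S.erase i then (1 : ℝ≥0∞) else 0,
    expect_drawnStash_resample C i fun T => if T = insert i S then (1 : ℝ≥0∞) else 0,
    ← expect_const_mul]
  refine expect_mono _ fun r _ => ?_
  simp only [h1, h2, h3, if_false, mul_zero, zero_add, add_zero]
  split_ifs
  · simpa using (skipProb_le_one C).trans hM
  · simp

end Markov

section Expect

open scoped ENNReal

theorem expect_le_const_add {α : Type} {p : PMF α} {f g : α → ℝ≥0∞} {x : ℝ≥0∞}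
    (h : ∀ a ∈ p.support, f a ≤ x + g a) : expect p f ≤ x + expect p g := by
  rw [← expect_const p x, ← expect_add]
  exact expect_mono p h

end Expect

/-! ### Random second buckets and the law of the view. -/

section Padding

open scoped ENNReal

variable {n t : ℕ} {U V : Type}

/-- The expectation of a function of the list of buckets of all RAM queries, given the keys of the
queries to the key-value storage. -/
noncomputable def padExpect (c : U → Bucket n × Bucket n) :
    List U → (List (Bucket n) → ℝ≥0∞) → ℝ≥0∞
  | [], G => G []
  | u :: us, G => expect (secondBucket (c u)) fun b₂ =>
      padExpect c us fun l => G ((c u).1 :: b₂ :: (c u).1 :: b₂ :: l)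

theorem padExpect_mono (c : U → Bucket n × Bucket n) (us : List U) {G G' : List (Bucket n) → ℝ≥0∞}
    (h : ∀ l, G l ≤ G' l) : padExpect c us G ≤ padExpect c us G' := by
  induction us generalizing G G' with
  | nil => exact h _
  | cons u us ih => exact expect_mono _ fun b _ => ih fun l => h _

theorem padExpect_expect {α : Type} (c : U → Bucket n × Bucket n) (us : List U) (p : PMF α)
    (G : α → List (Bucket n) → ℝ≥0∞) :
    padExpect c us (fun l => expect p fun a => G a l) =
      expect p fun a => padExpect c us (G a) := by
  induction us generalizing G with
  | nil => rfl
  | cons u us ih =>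
    simp only [padExpect]
    rw [← expect_comm]
    refine expect_congr _ fun b _ => ?_
    exact ih fun a l => G a ((c u).1 :: b :: (c u).1 :: b :: l)

theorem padExpect_add (c : U → Bucket n × Bucket n) (us : List U)
    (G G' : List (Bucket n) → ℝ≥0∞) :
    padExpect c us (fun l => G l + G' l) = padExpect c us G + padExpect c us G' := by
  induction us generalizing G G' with
  | nil => rfl
  | cons u us ih => simp only [padExpect, ih, expect_add]

theorem padExpect_const (c : U → Bucket n × Bucket n) (us : List U) (x : ℝ≥0∞) :
    padExpect c us (fun _ => x) = x := by
  induction us with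
  | nil => rfl
  | cons u us ih => simp only [padExpect, ih, expect_const]

theorem padExpect_const_mul (c : U → Bucket n × Bucket n) (us : List U) (x : ℝ≥0∞)
    (G : List (Bucket n) → ℝ≥0∞) :
    padExpect c us (fun l => x * G l) = x * padExpect c us G := by
  induction us generalizing G with
  | nil => rfl
  | cons u us ih => simp only [padExpect, ih, expect_const_mul]

theorem padExpect_length (c : U → Bucket n × Bucket n) (us : List U) :
    padExpect c us (fun l => (l.length : ℝ≥0∞)) = 4 * us.length := by
  induction us with
  | nil => simp [padExpect]
  | cons u us ih =>
    simp only [padExpect, List.length_cons, Nat.cast_add, Nat.cast_one, padExpect_add, ih,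
      padExpect_const, expect_const]
    ring

/-- Replacing the key of one query replaces four RAM queries. -/
theorem padExpect_le {L : ℝ≥0∞} (c : U → Bucket n × Bucket n) (pre post : List U) (u u' : U)
    {G : List (Bucket n) → ℝ≥0∞}
    (hG : ∀ pre post i i', G (pre ++ i :: post) ≤ L * G (pre ++ i' :: post)) :
    padExpect c (pre ++ u :: post) G ≤ L ^ 4 * padExpect c (pre ++ u' :: post) G := by
  induction pre generalizing G with
  | nil =>
    simp only [List.nil_append, padExpect]
    -- The two padding buckets `b` and `b'` follow different laws. Averaging each side over the
    -- variable missing from it reduces the claim to an inequality for every pair.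
    rw [← expect_const (secondBucket (c u')) (expect (secondBucket (c u)) _), ← expect_const_mul]
    refine expect_mono _ fun b' _ => ?_
    rw [← expect_const (secondBucket (c u)) (L ^ 4 * _)]
    refine expect_mono _ fun b _ => ?_
    rw [← padExpect_const_mul]
    refine padExpect_mono _ _ fun l => ?_
    calc G ((c u).1 :: b :: (c u).1 :: b :: l)
        ≤ L * G ((c u').1 :: b :: (c u).1 :: b :: l) := hG [] _ _ _
      _ ≤ L * (L * G ((c u').1 :: b' :: (c u).1 :: b :: l)) := by
          gcongr
          exact hG [(c u').1] _ _ _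
      _ ≤ L * (L * (L * G ((c u').1 :: b' :: (c u').1 :: b :: l))) := by
          gcongr
          exact hG [(c u').1, b'] _ _ _
      _ ≤ L * (L * (L * (L * G ((c u').1 :: b' :: (c u').1 :: b' :: l)))) := by
          gcongr
          exact hG [(c u').1, b', (c u').1] _ _ _
      _ = _ := by ring
  | cons v pre ih =>
    simp only [List.cons_append, padExpect]
    rw [← expect_const_mul]
    refine expect_mono _ fun b _ => ih fun pre' post' i i' => ?_
    exact hG ((c v).1 :: b :: (c v).1 :: b :: pre') post' i i'

/-- What the server sees in the queries to the key-value storage. -/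
def viewOf (t : ℕ) : List (Bucket n × Bucket n) → List (List (Transfer n t))
  | a :: b :: c :: d :: l =>
      (ramTransfers t a.1 a.2 ++ ramTransfers t b.1 b.2 ++ ramTransfers t c.1 c.2
        ++ ramTransfers t d.1 d.2) :: viewOf t l
  | _ => []

variable [DecidableEq U]

theorem kvsStep_choices_stashed (s : State n t U V) (q : Query U V) (b₂ : Bucket n)
    (ω₁ ω₂ ω₃ ω₄ : Bucket n × Bucket n × Bool) :
    (kvsStep s q b₂ ω₁ ω₂ ω₃ ω₄).2.choices = s.choices ∧
      (kvsStep s q b₂ ω₁ ω₂ ω₃ ω₄).2.stashed =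
        stashNext (stashNext (stashNext (stashNext s.stashed (s.choices q.1).1 ω₁.2.2) b₂ ω₂.2.2)
          (s.choices q.1).1 ω₃.2.2) b₂ ω₄.2.2 := by
  have h2 : ∀ (s : State n t U V) (root : List (U × V)),
    State.stashed { s with superRoot := root } = s.stashed := fun _ _ => rfl
  constructor
  · simp [kvsStep]
  · simp only [kvsStep, stashed_ramNext, h2, stashNext]

variable [NeZero n]

/-- Each padding bucket has a law fixed by the mapping alone, so all of them can be drawn before the
RAM coins; the rest of the view is then the chain on sets of stashed buckets. -/
theorem expect_runQueries_view (C : ℕ) (Q : List (Query U V)) (s : State n t U V)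
    (f : List (List (Transfer n t)) → ℝ≥0∞) :
    expect (runQueries C Q s) (fun l => f (l.map StepLog.transfers)) =
      padExpect s.choices (Q.map Prod.fst) fun l =>
        runExpect C l (fun w => f (viewOf t w)) s.stashed := by
  induction Q generalizing s f with
  | nil => simp [runQueries, expect_pure, padExpect, runExpect, viewOf]
  | cons q Q ih =>
    rw [runQueries_cons, kvsQuery_eq]
    simp only [expect_bind, expect_map, expect_pure, List.map_cons, padExpect, runExpect,
      padExpect_expect, viewOf]
    refine expect_congr _ fun b₂ _ => expect_congr _ fun ω₁ _ => expect_congr _ fun ω₂ _ =>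
      expect_congr _ fun ω₃ _ => expect_congr _ fun ω₄ _ => ?_
    obtain ⟨h1, h2⟩ := kvsStep_choices_stashed s q b₂ ω₁ ω₂ ω₃ ω₄
    rw [ih (kvsStep s q b₂ ω₁ ω₂ ω₃ ω₄).2
      fun l => f ((kvsStep s q b₂ ω₁ ω₂ ω₃ ω₄).1.transfers :: l), h1, h2]
    rfl

/-- The law of the view of the server. -/
theorem expect_view [Fintype U] (C : ℕ) (D : List (U × V)) (Q : List (Query U V))
    (f : List (List (Transfer n t)) → ℝ≥0∞) :
    expect ((execute n t C D Q).map Execution.view) f =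
      expect (PMF.uniformOfFintype (U → Bucket n × Bucket n)) fun c =>
        padExpect c (Q.map Prod.fst) fun l =>
          ∑ S, stashLaw C S * runExpect C l (fun w => f (viewOf t w)) S := by
  have h1 : ∀ (s : State n t U V) (S : Finset (Bucket n)), (s.withStash S).choices = s.choices :=
    fun _ _ => rfl
  rw [execute_eq]
  simp only [expect_map, expect_bind, Execution.view, expect_runQueries_view, h1,
    choices_storeAll, stashed_withStash]
  refine expect_congr _ fun c _ => ?_
  rw [← padExpect_expect]
  simp only [expect_drawnStash]

/-- Changing the key of one query. -/
theorem expect_view_le [Fintype U] {C : ℕ} {M : ℝ≥0∞} (h1 : 1 ≤ M)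
    (hM : 1 ≤ M * (numBuckets n : ℝ≥0∞)⁻¹)
    (hM' : 1 ≤ M * (stashProb n C * (numBuckets n : ℝ≥0∞)⁻¹)) (D : List (U × V))
    {Q Q' : List (Query U V)} {pre post : List U} {u u' : U}
    (hQ : Q.map Prod.fst = pre ++ u :: post) (hQ' : Q'.map Prod.fst = pre ++ u' :: post)
    (f : List (List (Transfer n t)) → ℝ≥0∞) :
    expect ((execute n t C D Q).map Execution.view) f ≤
      (8 * M ^ 6) ^ 4 * expect ((execute n t C D Q').map Execution.view) f := by
  rw [expect_view, expect_view, ← expect_const_mul, hQ, hQ']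
  refine expect_mono _ fun c _ => padExpect_le c pre post u u' fun pre' post' i i' => ?_
  refine sum_runExpect_le h1 hM hM' pre' post' i i' (upward_stashLaw (hM'.trans ?_)) _
  gcongr
  exact mul_le_of_le_one_right' (ENNReal.inv_le_one.2 one_le_numBuckets)

/-! ### The size of the stash -/

/-- The expected number of RAM queries after which more than `A` buckets are stashed. -/
noncomputable def stashExcess (C : ℕ) (A : ℝ) : List (Bucket n) → Finset (Bucket n) → ℝ≥0∞
  | [], _ => 0
  | i :: is, S => expect (ramNoise C i (decide (i ∈ S))) fun ω =>
      (if A < ((stashNext S i ω.2.2).card : ℝ) then 1 else 0) +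
        stashExcess C A is (stashNext S i ω.2.2)

/-- The probability that more than `A` buckets are stashed initially. -/
noncomputable def stashTail (n : ℕ) [NeZero n] (C : ℕ) (A : ℝ) : ℝ≥0∞ :=
  expect (PMF.uniformOfFintype (Bucket n → Bucket n)) fun r =>
    if A < ((drawnStash C r).card : ℝ) then 1 else 0

/-- The coin that decides re-entry into the stash ignores whether `i` was there; stationarity rests
on this. -/
theorem expect_ramNoise_bit (C : ℕ) (i : Bucket n) (m : Bool) (k : Bool → ℝ≥0∞) :
    expect (ramNoise C i m) (fun ω => k ω.2.2) = stashProb n C * k true + skipProb n C * k false := by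
  simp only [ramNoise, expect_bind, apply_ite (fun p => expect p fun ω : Bucket n × Bucket n × Bool => k ω.2.2), expect_map,
    expect_pure, expect_const, expect_lt_ite]

/-- The law of the set of stashed buckets is stationary. -/
theorem expect_stashNext (C : ℕ) (i : Bucket n) (g : Finset (Bucket n) → ℝ≥0∞) :
    expect (PMF.uniformOfFintype (Bucket n → Bucket n)) (fun r =>
      expect (ramNoise C i (decide (i ∈ drawnStash C r))) fun ω =>
        g (stashNext (drawnStash C r) i ω.2.2)) =
      expect (PMF.uniformOfFintype (Bucket n → Bucket n)) fun r => g (drawnStash C r) := by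
  rw [expect_drawnStash_resample C i g]
  refine expect_congr _ fun r _ => ?_
  exact expect_ramNoise_bit C i _ fun m => g (stashNext (drawnStash C r) i m)

/-- By stationarity every RAM query contributes the same tail, whatever bucket it addresses. -/
theorem expect_stashExcess (C : ℕ) (A : ℝ) (is : List (Bucket n)) :
    expect (PMF.uniformOfFintype (Bucket n → Bucket n))
      (fun r => stashExcess C A is (drawnStash C r)) = is.length * stashTail n C A := by
  induction is with
  | nil => simp [stashExcess, expect_const]
  | cons i is ih =>
    simp only [stashExcess]
    rw [expect_stashNext C i fun S => (if A < (S.card : ℝ) then 1 else 0) + stashExcess C A is S,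
      expect_add, ih, stashTail]
    simp only [List.length_cons, Nat.cast_add, Nat.cast_one]
    ring

/-- The items that are written by a list of queries. -/
def writes (Q : List (Query U V)) : List (U × V) :=
  Q.filterMap fun q => match q.2 with
    | .read => none
    | .write v => some (q.1, v)

/-- The client exceeds the size `B` in one of the steps. -/
def Exceeds (B : ℝ) (l : List (StepLog n t V)) : Prop :=
  ∃ x ∈ l.flatMap StepLog.clientSizes, B < (x : ℝ)

/-- While the super root has at most `R` blocks, more than `B` blocks on the client force more than
`A` stashed buckets. The probability that this ever happens is at most the expected number of times
it does. -/
theorem expect_exceeds_le (C : ℕ) {A R B : ℝ} (hB : A * Fintype.card (Pos n t) + R ≤ B)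
    (c : U → Bucket n × Bucket n) (Q : List (Query U V)) :
    ∀ (D : List (U × V)) (s : State n t U V), s.choices = c →
      s.Represents (storeAll t c D).server → s.superRoot = (storeAll t c D).superRoot →
      (∀ P, P <+: Q → ((storeAll t c (D ++ writes P)).superRoot.length : ℝ) ≤ R) →
      expect (runQueries C Q s) ({l | Exceeds B l}.indicator 1) ≤
        padExpect c (Q.map Prod.fst) fun l => stashExcess C A l s.stashed := by
  induction Q with
  | nil =>
    intro D s _ _ _ _
    simp [runQueries, expect_pure, Exceeds]
  | cons q Q ih =>
    intro D s hc hM hroot hR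
    -- Queries act on the memory as the setup does, so the state after a prefix of queries is that
    -- of storing `D` followed by the writes.
    have hstore : ∀ (M : Addr n t → Block U V) (root : List (U × V)),
        M = (storeAll t c D).server → root = (storeAll t c D).superRoot →
        (memQuery (c q.1) q M root).2.1 = (storeAll t c (D ++ writes [q])).server ∧
        (memQuery (c q.1) q M root).2.2 = (storeAll t c (D ++ writes [q])).superRoot := by
      rintro M root rfl rfl
      obtain ⟨u, _ | v⟩ := q
      · simp [writes, memQuery]
      · have : writes [((u, Op.write v) : Query U V)] = [(u, v)] := rfl
        rw [this, storeAll_concat, initStore_eq, choices_storeAll]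
        exact ⟨rfl, rfl⟩
    have hw : ∀ P : List (Query U V), writes (q :: P) = writes [q] ++ writes P := fun P =>
      List.filterMap_append (l := [q])
    have hR0 : (s.superRoot.length : ℝ) ≤ R := by
      have := hR [] List.nil_prefix
      rwa [show writes ([] : List (Query U V)) = [] from rfl, List.append_nil, ← hroot] at this
    have hR1 : ((memQuery (c q.1) q (storeAll t c D).server s.superRoot).2.2.length : ℝ) ≤ R := by
      rw [(hstore _ _ rfl hroot).2]
      exact hR [q] (by simp)
    have hsize : ∀ (S : Finset (Bucket n)) (k : ℕ), (k : ℝ) ≤ R →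
        B < ((S.card * Fintype.card (Pos n t) + k : ℕ) : ℝ) → A < (S.card : ℝ) := by
      intro S k hk h
      by_contra! hA
      have : (S.card : ℝ) * Fintype.card (Pos n t) ≤ A * Fintype.card (Pos n t) := by gcongr
      push_cast at h
      linarith
    rw [runQueries_cons, kvsQuery_eq]
    simp only [expect_bind, expect_map, expect_pure, List.map_cons, padExpect, stashExcess,
      padExpect_expect, padExpect_add, padExpect_const, hc]
    refine expect_mono _ fun b₂ hb₂ => expect_mono _ fun ω₁ _ => expect_le_const_add fun ω₂ _ => ?_
    rw [← add_assoc]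
    refine expect_le_const_add fun ω₃ _ => ?_
    rw [← add_assoc]
    refine expect_le_const_add fun ω₄ _ => ?_
    rw [← add_assoc]
    obtain ⟨-, h2, h3, h4, h5, h6⟩ :=
      kvsStep_spec hM q (mem_secondBucket (hc ▸ hb₂)) ω₁ ω₂ ω₃ ω₄
    rw [hc] at h2 h3 h5 h6
    set x := kvsStep s q b₂ ω₁ ω₂ ω₃ ω₄ with hx
    rw [(hstore _ _ rfl hroot).1] at h2
    rw [(hstore _ _ rfl hroot).2] at h3
    have ih' := ih (D ++ writes [q]) x.2 (h4.trans hc) h2 h3 fun P hP => by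
      rw [List.append_assoc, ← hw]
      exact hR (q :: P) (List.cons_prefix_cons.2 ⟨rfl, hP⟩)
    rw [h5] at ih'
    refine le_trans ?_ (add_le_add_right ih' _)
    generalize stashNext s.stashed (c q.1).1 ω₁.2.2 = S₁ at *
    generalize stashNext S₁ b₂ ω₂.2.2 = S₂ at *
    generalize stashNext S₂ (c q.1).1 ω₃.2.2 = S₃ at *
    generalize stashNext S₃ b₂ ω₄.2.2 = S₄ at *
    refine expect_le_const_add fun l _ => ?_
    by_cases hl : Exceeds B (x.1 :: l)
    · rw [Set.indicator_of_mem (by exact hl), Pi.one_apply]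
      obtain ⟨y, hy, hBy⟩ := hl
      rw [List.flatMap_cons, h6] at hy
      simp only [List.cons_append, List.nil_append, List.mem_cons] at hy
      rcases hy with rfl | rfl | rfl | rfl | hy
      · rw [if_pos (hsize S₁ _ hR0 hBy)]
        exact le_self_add.trans (le_self_add.trans (le_self_add.trans le_self_add))
      · rw [if_pos (hsize S₂ _ hR0 hBy)]
        exact le_add_self.trans (le_self_add.trans (le_self_add.trans le_self_add))
      · rw [if_pos (hsize S₃ _ hR1 hBy)]
        exact le_add_self.trans (le_self_add.trans le_self_add)
      · rw [if_pos (hsize S₄ _ hR1 hBy)]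
        exact le_add_self.trans le_self_add
      · rw [Set.indicator_of_mem (show l ∈ {l | Exceeds B l} from ⟨y, hy, hBy⟩)]
        exact le_add_self
    · rw [Set.indicator_of_notMem (by exact hl)]
      exact zero_le

/-- The probability that the client exceeds its size is bounded by the probability that the super root
does and the expected number of times at which the stash does. -/
theorem expect_clientSizes_le [Fintype U] (C : ℕ) {A R B : ℝ}
    (hB : A * Fintype.card (Pos n t) + R ≤ B) (D : List (U × V)) (Q : List (Query U V)) :
    expect (execute n t C D Q) ({e : Execution n t V | ∃ x ∈ e.clientSizes, B < (x : ℝ)}.indicator 1) ≤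
      expect (PMF.uniformOfFintype (U → Bucket n × Bucket n))
        ({c | ∃ P, P <+: Q ∧ R < ((storeAll t c (D ++ writes P)).superRoot.length : ℝ)}.indicator 1)
      + (4 * Q.length + 1) * stashTail n C A := by
  rw [execute_eq, ← expect_const (PMF.uniformOfFintype (U → Bucket n × Bucket n)) (_ * _),
    ← expect_add, expect_bind]
  refine expect_mono _ fun c _ => ?_
  -- The super root is determined by the mapping `c`, so the bad event is removed before any RAM
  -- coin is considered.
  by_cases hc : ∃ P, P <+: Q ∧ R < ((storeAll t c (D ++ writes P)).superRoot.length : ℝ)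
  · rw [Set.indicator_of_mem (by exact hc)]
    exact (expect_indicator_le_one _ _).trans le_self_add
  · rw [Set.indicator_of_notMem (by exact hc), zero_add, expect_bind]
    push Not at hc
    have h1 : ∀ r, expect ((runQueries C Q ((storeAll t c D).withStash (drawnStash C r))).map
          fun l => (⟨((storeAll t c D).withStash (drawnStash C r)).clientBlocks, l⟩ :
            Execution n t V)) ({e : Execution n t V | ∃ x ∈ e.clientSizes, B < (x : ℝ)}.indicator 1) ≤
        (if A < ((drawnStash C r).card : ℝ) then 1 else 0) +
          padExpect c (Q.map Prod.fst) fun l => stashExcess C A l (drawnStash C r) := by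
      intro r
      have hex := expect_exceeds_le C hB c Q D ((storeAll t c D).withStash (drawnStash C r))
        (choices_storeAll c D) (represents_withStash _ _) rfl hc
      rw [stashed_withStash] at hex
      refine le_trans ?_ (add_le_add_right hex _)
      rw [expect_map]
      refine expect_le_const_add fun l _ => ?_
      have hcb := clientBlocks_withStash (storeAll t c D) (drawnStash C r)
      by_cases hl : Exceeds B l
      · rw [Set.indicator_of_mem (show l ∈ {l | Exceeds B l} from hl)]
        exact (Set.indicator_le_self' (by simp) _).trans le_add_self
      · rw [Set.indicator_of_notMem (show l ∉ {l | Exceeds B l} from hl), add_zero]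
        refine Set.indicator_apply_le' (fun he => ?_) fun _ => zero_le
        obtain ⟨y, hy, hBy⟩ := he
        rcases List.mem_cons.1 hy with rfl | hy
        · have hR0 := hc [] List.nil_prefix
          rw [show writes ([] : List (Query U V)) = [] from rfl, List.append_nil] at hR0
          rw [if_pos, Pi.one_apply]
          by_contra! hA
          have : ((drawnStash C r).card : ℝ) * Fintype.card (Pos n t) ≤
            A * Fintype.card (Pos n t) := by gcongr
          simp only [hcb] at hBy
          push_cast at hBy
          linarith
        · exact absurd ⟨y, hy, hBy⟩ hl
    refine (expect_mono _ fun r _ => h1 r).trans ?_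
    rw [expect_add, ← padExpect_expect]
    simp only [expect_stashExcess]
    rw [← stashTail]
    simp only [mul_comm _ (stashTail n C A), padExpect_const_mul, padExpect_length,
      List.length_map]
    rw [mul_add, mul_one, add_comm]

end Padding

/-! ### The tail of the size of the stash -/

section StashTail

open scoped ENNReal

theorem expect_uniform_prod {ι α : Type} [Fintype ι] [DecidableEq ι] [Fintype α] [Nonempty α]
    (f : α → ℝ≥0∞) :
    expect (PMF.uniformOfFintype (ι → α)) (fun c => ∏ i, f (c i)) =
      expect (PMF.uniformOfFintype α) f ^ Fintype.card ι := by
  have h := Finset.prod_univ_sum (fun _ : ι => (Finset.univ : Finset α)) fun _ x => f x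
  rw [Fintype.piFinset_univ] at h
  rw [expect_uniform, expect_uniform, ← h, Finset.prod_const, Finset.card_univ, mul_pow,
    Fintype.card_fun, Nat.cast_pow, ENNReal.inv_pow]

variable {n : ℕ} [NeZero n]

theorem stashProb_le (C : ℕ) : stashProb n C ≤ C * (numBuckets n : ℝ≥0∞)⁻¹ := by
  rw [stashProb, expect_uniform, Fintype.card_fin, mul_comm, Finset.sum_boole]
  gcongr
  rw [← Finset.card_range C]
  refine Finset.card_le_card_of_injOn (fun r => (r : ℕ)) (fun r hr => ?_) fun _ _ _ _ h => Fin.ext h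
  simpa using hr

/-- For `C ≥ 1` the draw `0` always puts the bucket into the stash. -/
theorem le_stashProb {C : ℕ} (hC : 1 ≤ C) : (numBuckets n : ℝ≥0∞)⁻¹ ≤ stashProb n C := by
  rw [stashProb, expect_uniform, Fintype.card_fin]
  refine le_mul_of_one_le_right' ?_
  set f : Bucket n → ℝ≥0∞ := fun r => if (r : ℕ) < C then 1 else 0 with hf
  have h : f 0 = 1 := if_pos hC
  exact h ▸ Finset.single_le_sum (f := f) (fun _ _ => zero_le) (Finset.mem_univ 0)

/-- A product of `b` independent factors of mean `1 + p ≤ exp (C / b)`. -/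
theorem expect_two_pow_drawnStash (C : ℕ) :
    expect (PMF.uniformOfFintype (Bucket n → Bucket n))
      (fun r => 2 ^ (drawnStash C r).card) ≤ ENNReal.ofReal (Real.exp C) := by
  have h1 : ∀ r : Bucket n → Bucket n, (2 : ℝ≥0∞) ^ (drawnStash C r).card =
      ∏ i, (fun x : Bucket n => if (x : ℕ) < C then (2 : ℝ≥0∞) else 1) (r i) := by
    intro r
    rw [drawnStash, Finset.prod_ite, Finset.prod_const, Finset.prod_const_one, mul_one]
  rw [funext h1, expect_uniform_prod (ι := Bucket n) (fun x : Bucket n => if (x : ℕ) < C then (2 : ℝ≥0∞) else 1), expect_lt_ite, Fintype.card_fin]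
  have hb : (0 : ℝ) < numBuckets n := Nat.cast_pos.2 (Nat.pos_of_ne_zero (NeZero.ne _))
  have h2 : stashProb n C * 2 + skipProb n C * 1 ≤
      ENNReal.ofReal (Real.exp (C / numBuckets n)) := by
    calc stashProb n C * 2 + skipProb n C * 1
        = (stashProb n C + skipProb n C) + stashProb n C := by ring
      _ ≤ 1 + C * (numBuckets n : ℝ≥0∞)⁻¹ := by
          rw [stashProb_add_skipProb]
          gcongr
          exact stashProb_le C
      _ = ENNReal.ofReal (1 + C / numBuckets n) := by
          rw [ENNReal.ofReal_add zero_le_one (by positivity), ENNReal.ofReal_one,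
            ENNReal.ofReal_div_of_pos hb, ENNReal.ofReal_natCast, ENNReal.ofReal_natCast,
            ENNReal.div_eq_inv_mul, mul_comm]
      _ ≤ _ := ENNReal.ofReal_le_ofReal (by linarith [Real.add_one_le_exp (C / numBuckets n : ℝ)])
  calc _ ≤ ENNReal.ofReal (Real.exp (C / numBuckets n)) ^ numBuckets n := by gcongr
    _ = ENNReal.ofReal (Real.exp C) := by
      rw [← ENNReal.ofReal_pow (Real.exp_pos _).le, ← Real.exp_nat_mul, mul_div_cancel₀ _ hb.ne']

/-- The pointwise Chernoff bound with base 2, used for the stash and for the load. -/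
theorem ite_lt_le_two_pow (k : ℕ) (s : ℝ) :
    (if s < (k : ℝ) then 1 else 0 : ℝ≥0∞) ≤
      2 ^ k * ENNReal.ofReal (Real.exp (-(Real.log 2 * s))) := by
  split_ifs with h
  · have h2 : (2 : ℝ≥0∞) ^ k = ENNReal.ofReal (Real.exp (Real.log 2 * k)) := by
      rw [mul_comm, Real.exp_nat_mul, Real.exp_log two_pos, ENNReal.ofReal_pow two_pos.le]
      simp
    rw [h2, ← ENNReal.ofReal_mul (Real.exp_pos _).le, ← Real.exp_add, ← ENNReal.ofReal_one]
    refine ENNReal.ofReal_le_ofReal (Real.one_le_exp ?_)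
    have := Real.log_pos one_lt_two
    nlinarith
  · exact zero_le

theorem stashTail_le {C : ℕ} {φ : ℝ} (h0 : 0 ≤ φ) (hC : (C : ℝ) ≤ φ) :
    stashTail n C (4 * φ) ≤ ENNReal.ofReal (Real.exp (-φ)) := by
  calc stashTail n C (4 * φ)
      ≤ ENNReal.ofReal (Real.exp C) * ENNReal.ofReal (Real.exp (-(Real.log 2 * (4 * φ)))) :=
        (expect_mono _ fun _ _ => ite_lt_le_two_pow _ _).trans
          ((expect_mul_const _ _ _).trans_le (mul_le_mul_left (expect_two_pow_drawnStash C) _))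
    _ = ENNReal.ofReal (Real.exp (C + -(Real.log 2 * (4 * φ)))) := by
        rw [← ENNReal.ofReal_mul (Real.exp_pos _).le, ← Real.exp_add]
    _ ≤ _ := by
        refine ENNReal.ofReal_le_ofReal (Real.exp_le_exp.2 ?_)
        -- The exponent is at most `φ - 4 * φ * log 2`, and `4 * log 2 > 2`.
        have := Real.log_two_gt_d9
        nlinarith

end StashTail

/-! ### The size of the super root -/

section Load

variable {n t : ℕ} {U V : Type}

/-- The number of items at height at least `i`, including those in the super root. -/
def highCount (i : ℕ) (M : Addr n t → Block U V) (root : List (U × V)) : ℕ :=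
  (Finset.univ.filter fun a : Addr n t => i ≤ (a.1.1 : ℕ) ∧ (M a).isSome).card + root.length

/-- The nodes of height `i` without an empty slot. -/
def fullNodes (i : Fin (treeHeight n + 1)) (M : Addr n t → Block U V) :
    Finset (Fin (numBuckets n / 2 ^ (i : ℕ))) :=
  Finset.univ.filter fun v => ∀ x : Fin t, (M (⟨i, v⟩, x)).isSome

/-- The node of height `i` in bucket `b` has no empty slot. -/
def FullAt (i : Fin (treeHeight n + 1)) (M : Addr n t → Block U V) (b : Bucket n) : Prop :=
  ∀ x : Fin t, (M (addr b (i, x))).isSome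

instance (i : Fin (treeHeight n + 1)) (M : Addr n t → Block U V) : DecidablePred (FullAt i M) :=
  fun _ => inferInstanceAs (Decidable (∀ _, _))

/-- Each full node of height `i` accounts for `t` separate items of that height. -/
theorem mul_card_fullNodes_le (i : Fin (treeHeight n + 1)) (M : Addr n t → Block U V)
    (root : List (U × V)) : t * (fullNodes i M).card ≤ highCount i M root := by
  have h : ((fullNodes i M) ×ˢ (Finset.univ : Finset (Fin t))).card ≤
      (Finset.univ.filter fun a : Addr n t => (i : ℕ) ≤ (a.1.1 : ℕ) ∧ (M a).isSome).card := by
    refine Finset.card_le_card_of_injOn (fun y => ((⟨i, y.1⟩ : Node n), y.2)) ?_ ?_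
    · intro y hy
      have hy1 : y.1 ∈ fullNodes i M := by simpa using hy
      have := (Finset.mem_filter.1 hy1).2 y.2
      simpa using this
    · rintro ⟨v, x⟩ _ ⟨v', x'⟩ _ h
      simpa using h
  rw [Finset.card_product, Finset.card_univ, Fintype.card_fin, mul_comm] at h
  exact h.trans (Nat.le_add_right _ _)

/-- A node of height `i` has at most `2 ^ i` leaves below it. -/
theorem card_fullAt_le (i : Fin (treeHeight n + 1)) (M : Addr n t → Block U V) :
    (Finset.univ.filter (FullAt i M)).card ≤ 2 ^ (i : ℕ) * (fullNodes i M).card := by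
  refine Finset.card_le_mul_card_image_of_maps_to
    (f := fun b : Bucket n => (⟨(b : ℕ) / 2 ^ (i : ℕ), div_lt_numBuckets n b i⟩ :
      Fin (numBuckets n / 2 ^ (i : ℕ)))) ?_ _ ?_
  · intro b hb
    exact Finset.mem_filter.2 ⟨Finset.mem_univ _, (Finset.mem_filter.1 hb).2⟩
  · intro v _
    calc _ ≤ (Finset.Ico ((v : ℕ) * 2 ^ (i : ℕ)) (((v : ℕ) + 1) * 2 ^ (i : ℕ))).card := by
          refine Finset.card_le_card_of_injOn (fun b => (b : ℕ)) ?_ fun _ _ _ _ h => Fin.ext h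
          intro b hb
          have hb' : (b : ℕ) / 2 ^ (i : ℕ) = v := congrArg Fin.val (Finset.mem_filter.1 hb).2
          rw [Finset.coe_Ico, Set.mem_Ico, ← hb']
          exact ⟨Nat.div_mul_le_self _ _, (Nat.div_lt_iff_lt_mul (by positivity)).1 (Nat.lt_succ_self _)⟩
      _ = _ := by rw [Nat.card_Ico, add_mul, one_mul, Nat.add_sub_cancel_left]

theorem fullNodes_mono {i : Fin (treeHeight n + 1)} {M M' : Addr n t → Block U V}
    (h : ∀ a, (M a).isSome → (M' a).isSome) : (fullNodes i M).card ≤ (fullNodes i M').card :=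
  Finset.card_le_card fun _ hv =>
    Finset.mem_filter.2 ⟨Finset.mem_univ _, fun x => h _ ((Finset.mem_filter.1 hv).2 x)⟩

theorem highCount_anti {i j : ℕ} (h : i ≤ j) (M : Addr n t → Block U V) (root : List (U × V)) :
    highCount j M root ≤ highCount i M root := by
  unfold highCount
  gcongr

theorem highCount_update_le (i : ℕ) (M : Addr n t → Block U V) (root : List (U × V)) (a : Addr n t)
    (y : U × V) :
    highCount i (Function.update M a (some y)) root ≤
      highCount i M root + if i ≤ (a.1.1 : ℕ) ∧ M a = none then 1 else 0 := by
  unfold highCount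
  rw [add_right_comm]
  gcongr
  split_ifs with h
  · refine (Finset.card_le_card (t := insert a _) fun a' ha' => ?_).trans (Finset.card_insert_le a _)
    by_cases haa : a' = a
    · exact Finset.mem_insert.2 (.inl haa)
    · refine Finset.mem_insert_of_mem ?_
      simpa [Function.update_of_ne haa] using ha'
  · refine Finset.card_le_card fun a' ha' => ?_
    simp only [Finset.mem_filter, Finset.mem_univ, true_and] at ha' ⊢
    by_cases haa : a' = a
    · subst haa
      refine ⟨ha'.1, Option.isSome_iff_ne_none.2 fun h' => h ⟨ha'.1, h'⟩⟩
    · rwa [Function.update_of_ne haa] at ha'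

variable [DecidableEq U]

/-- Slots are never freed, so the number of full nodes only grows; a bound on it at the end
therefore holds at all earlier times. -/
theorem isSome_storeIn (b : Bucket n × Bucket n) (u : U) (v : V) (M : Addr n t → Block U V)
    (root : List (U × V)) (a : Addr n t) (ha : (M a).isSome) :
    ((storeIn b u v M root).1 a).isSome := by
  have hc := storeCase_storeIn b u v M root
  generalize storeIn b u v M root = r at hc
  have upd : ∀ a' : Addr n t, (Function.update M a' (some (u, v)) a).isSome := by
    intro a'
    by_cases h : a = a'
    · subst h; simp
    · rwa [Function.update_of_ne h]
  cases hc with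
  | update a' => exact upd a'
  | updateRoot => exact ha
  | fill a' => exact upd a'
  | extend => exact ha

/-- Storing a new key adds an item of height greater than `i` only if the two nodes of height `i`
are full. -/
theorem highCount_storeIn_le {c : U → Bucket n × Bucket n} {M : Addr n t → Block U V}
    {root : List (U × V)} {m : U → Option V} (h : Implements c M root m) (u : U) (v : V)
    (i : Fin (treeHeight n + 1)) :
    highCount (i + 1) (storeIn (c u) u v M root).1 (storeIn (c u) u v M root).2 ≤
      highCount (i + 1) M root +
        if m u = none ∧ FullAt i M (c u).1 ∧ FullAt i M (c u).2 then 1 else 0 := by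
  have hc := storeCase_storeIn (c u) u v M root
  generalize storeIn (c u) u v M root = r at hc
  cases hc with
  | update a v₀ ha =>
    refine (highCount_update_le _ _ _ _ _).trans ?_
    rw [if_neg (by simp [ha])]
    exact Nat.le_add_right _ _
  | updateRoot _ => simp [highCount]
  | fill a ha hp hr hno hlow =>
    refine (highCount_update_le _ _ _ _ _).trans ?_
    split_ifs with h1 h2
    · exact le_rfl
    · refine absurd ⟨h.not_mem_of_none hr hno, fun x => ?_, fun x => ?_⟩ h2
      · exact Option.isSome_iff_ne_none.2 (hlow (i, x) (Fin.lt_def.2 h1.1)).1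
      · exact Option.isSome_iff_ne_none.2 (hlow (i, x) (Fin.lt_def.2 h1.1)).2
    · exact Nat.le_add_right _ _
    · exact le_rfl
  | extend hr hno hfull =>
    rw [if_pos ⟨h.not_mem_of_none hr hno,
      fun x => Option.isSome_iff_ne_none.2 (hfull (i, x)).1,
      fun x => Option.isSome_iff_ne_none.2 (hfull (i, x)).2⟩]
    simp [highCount, add_assoc]

theorem highCount_zero_storeIn_le {c : U → Bucket n × Bucket n} {M : Addr n t → Block U V}
    {root : List (U × V)} {m : U → Option V} (h : Implements c M root m) (u : U) (v : V) :
    highCount 0 (storeIn (c u) u v M root).1 (storeIn (c u) u v M root).2 ≤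
      highCount 0 M root + if m u = none then 1 else 0 := by
  have hc := storeCase_storeIn (c u) u v M root
  generalize storeIn (c u) u v M root = r at hc
  cases hc with
  | update a v₀ ha =>
    refine (highCount_update_le _ _ _ _ _).trans ?_
    rw [if_neg (by simp [ha])]
    exact Nat.le_add_right _ _
  | updateRoot _ => simp [highCount]
  | fill a ha hp hr hno hlow =>
    refine (highCount_update_le _ _ _ _ _).trans ?_
    rw [if_pos (h.not_mem_of_none hr hno)]
    exact Nat.add_le_add_left (by split_ifs <;> simp) _
  | extend hr hno hfull =>
    rw [if_pos (h.not_mem_of_none hr hno)]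
    simp [highCount, add_assoc]

theorem initialDict_eq_none {D : List (U × V)} {u : U} :
    initialDict D u = none ↔ u ∉ D.map Prod.fst := by
  induction D using List.reverseRecOn with
  | nil => simp [initialDict]
  | append_singleton D e ih =>
    have h1 : initialDict (D ++ [e]) = Function.update (initialDict D) e.1 (some e.2) := by
      simp [initialDict]
    rw [h1]
    by_cases hu : u = e.1
    · subst hu; simp
    · rw [Function.update_of_ne hu, ih]
      simp [hu]

/-- The keys of a list of items. -/
def keys (D : List (U × V)) : Finset U := (D.map Prod.fst).toFinset

theorem keys_concat (D : List (U × V)) (e : U × V) : keys (D ++ [e]) = insert e.1 (keys D) := by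
  ext u
  simp [keys]

/-- Storing a key again updates it in place, so only distinct keys take up space. -/
theorem highCount_zero_storeAll (c : U → Bucket n × Bucket n) (D : List (U × V)) :
    highCount 0 (storeAll t c D).server (storeAll t c D).superRoot ≤ (keys D).card := by
  induction D using List.reverseRecOn with
  | nil => simp [storeAll, highCount]
  | append_singleton D e ih =>
    rw [storeAll_concat, initStore_eq, choices_storeAll, keys_concat]
    refine (highCount_zero_storeIn_le (implements_storeAll c D) e.1 e.2).trans ?_
    have h : initialDict D e.1 = none ↔ e.1 ∉ keys D := by
      rw [initialDict_eq_none, keys, List.mem_toFinset]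
    by_cases he : e.1 ∈ keys D
    · rw [if_neg fun h' => h.1 h' he, Finset.insert_eq_of_mem he]
      exact ih
    · rw [if_pos (h.2 he), Finset.card_insert_of_notMem he]
      exact Nat.add_le_add_right ih 1

/-- The stored items depend on the choices for their keys only. -/
theorem storeAll_congr {c c' : U → Bucket n × Bucket n} {D : List (U × V)}
    (h : ∀ u ∈ keys D, c u = c' u) :
    (storeAll t c D).server = (storeAll t c' D).server ∧
      (storeAll t c D).superRoot = (storeAll t c' D).superRoot := by
  induction D using List.reverseRecOn with
  | nil => exact ⟨rfl, rfl⟩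
  | append_singleton D e ih =>
    rw [keys_concat] at h
    obtain ⟨h1, h2⟩ := ih fun u hu => h u (Finset.mem_insert_of_mem hu)
    simp only [storeAll_concat, initStore_eq, choices_storeAll, h1, h2,
      h e.1 (Finset.mem_insert_self _ _), and_self]

end Load

/-! ### Layered induction over the heights of the trees. -/

section LoadTail

open scoped ENNReal

variable {n t : ℕ} {U V : Type} [NeZero n]

/-- The two choices are independent, so the probability `q` that both hit full nodes is a square,
and the moment is `1 + q`. -/
theorem expect_fullAt_le (i : Fin (treeHeight n + 1)) (M : Addr n t → Block U V) {ν : ℝ}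
    (hν : ((fullNodes i M).card : ℝ) ≤ ν) :
    expect (PMF.uniformOfFintype (Bucket n × Bucket n))
      (fun x => if FullAt i M x.1 ∧ FullAt i M x.2 then 2 else 1) ≤
      1 + ENNReal.ofReal ((ν * 2 ^ (i : ℕ) / numBuckets n) ^ 2) := by
  have hb : (0 : ℝ) < numBuckets n := Nat.cast_pos.2 (Nat.pos_of_ne_zero (NeZero.ne _))
  set k := (Finset.univ.filter (FullAt i M)).card with hk
  set f : Bucket n → ℝ≥0∞ := fun b => if FullAt i M b then 1 else 0 with hf
  have h1 : ∀ x : Bucket n × Bucket n, (if FullAt i M x.1 ∧ FullAt i M x.2 then 2 else 1 : ℝ≥0∞) =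
      1 + f x.1 * f x.2 := by
    intro x
    by_cases h1 : FullAt i M x.1 <;> by_cases h2 : FullAt i M x.2 <;> simp [hf, h1, h2]
    norm_num
  have h2 : ∑ x : Bucket n × Bucket n, f x.1 * f x.2 = k * k := by
    rw [Fintype.sum_prod_type, ← Fintype.sum_mul_sum, hk, ← Finset.sum_boole]
  have h3 : (k : ℝ) ≤ ν * 2 ^ (i : ℕ) := by
    have := card_fullAt_le i M
    rw [← hk] at this
    calc (k : ℝ) ≤ ((2 ^ (i : ℕ) * (fullNodes i M).card : ℕ) : ℝ) := Nat.cast_le.2 this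
      _ = 2 ^ (i : ℕ) * (fullNodes i M).card := by push_cast; ring
      _ ≤ 2 ^ (i : ℕ) * ν := by gcongr
      _ = _ := mul_comm _ _
  simp only [h1, expect_add, expect_const]
  gcongr
  rw [expect_uniform, h2, Fintype.card_prod, Fintype.card_fin]
  calc ((numBuckets n * numBuckets n : ℕ) : ℝ≥0∞)⁻¹ * (k * k)
      = ENNReal.ofReal ((k / numBuckets n) ^ 2) := by
        rw [div_pow, ENNReal.ofReal_div_of_pos (by positivity), ENNReal.div_eq_inv_mul,
          sq, sq, ← Nat.cast_mul, ← Nat.cast_mul, ← Nat.cast_mul, ENNReal.ofReal_natCast,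
          ENNReal.ofReal_natCast]
    _ ≤ _ := by
        refine ENNReal.ofReal_le_ofReal ?_
        gcongr

variable [DecidableEq U] [Fintype U]

/-- The moment of the number of items above height `i` on the event that at most `ν` nodes of height
`i` are full. -/
noncomputable def loadMoment (i : Fin (treeHeight n + 1)) (ν : ℝ) (s : State n t U V) : ℝ≥0∞ :=
  if ((fullNodes i s.server).card : ℝ) ≤ ν then 2 ^ highCount (i + 1) s.server s.superRoot else 0

/-- The state before a new key does not depend on its choices, so they can be redrawn: each new key
costs one factor `1 + q`. Keeping the event "at most `ν` full nodes" inside the moment replaces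
conditioning. -/
theorem expect_loadMoment_le (i : Fin (treeHeight n + 1)) (ν : ℝ) (D : List (U × V)) :
    expect (PMF.uniformOfFintype (U → Bucket n × Bucket n))
      (fun c => loadMoment i ν (storeAll t c D)) ≤
      (1 + ENNReal.ofReal ((ν * 2 ^ (i : ℕ) / numBuckets n) ^ 2)) ^ (keys D).card := by
  induction D using List.reverseRecOn with
  | nil =>
    have h : ∀ c, loadMoment i ν (storeAll t c ([] : List (U × V))) ≤ 1 := by
      intro c
      unfold loadMoment
      split_ifs
      · simp [storeAll, highCount]
      · exact zero_le_one
    calc _ ≤ _ := expect_mono _ fun c _ => h c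
      _ = _ := by simp [expect_const, keys]
  | append_singleton D e ih =>
    -- The event after the last item implies the event before it, since full nodes stay full, so the
    -- moment of the shorter list can be used.
    have step : ∀ c : U → Bucket n × Bucket n, loadMoment i ν (storeAll t c (D ++ [e])) ≤
        loadMoment i ν (storeAll t c D) * if e.1 ∉ keys D ∧
          FullAt i (storeAll t c D).server (c e.1).1 ∧ FullAt i (storeAll t c D).server (c e.1).2
          then 2 else 1 := by
      intro c
      have h1 := highCount_storeIn_le (implements_storeAll (t := t) c D) e.1 e.2 i
      have h2 : (fullNodes i (storeAll t c D).server).card ≤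
          (fullNodes i (storeIn (c e.1) e.1 e.2 (storeAll t c D).server
            (storeAll t c D).superRoot).1).card :=
        fullNodes_mono fun a ha => isSome_storeIn _ _ _ _ _ a ha
      have h3 : initialDict D e.1 = none ↔ e.1 ∉ keys D := by
        rw [initialDict_eq_none, keys, List.mem_toFinset]
      simp only [storeAll_concat, initStore_eq, choices_storeAll, loadMoment]
      simp only [h3] at h1
      by_cases hle : ((fullNodes i (storeIn (c e.1) e.1 e.2 (storeAll t c D).server
            (storeAll t c D).superRoot).1).card : ℝ) ≤ ν
      · rw [if_pos hle, if_pos ((Nat.cast_le.2 h2).trans hle)]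
        refine (pow_le_pow_right₀ one_le_two h1).trans ?_
        rw [pow_add]
        gcongr
        split_ifs <;> simp
      · rw [if_neg hle]
        exact zero_le
    refine (expect_mono _ fun c _ => step c).trans ?_
    rw [keys_concat]
    by_cases he : e.1 ∈ keys D
    · rw [Finset.insert_eq_of_mem he]
      simpa [he] using ih
    · rw [Finset.card_insert_of_notMem he, expect_uniform_resample e.1, pow_succ]
      refine le_trans ?_ (mul_le_mul_left ih _)
      rw [← expect_mul_const]
      refine expect_mono _ fun c _ => ?_
      have hc : ∀ x, (storeAll t (Function.update c e.1 x) D).server = (storeAll t c D).server ∧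
          (storeAll t (Function.update c e.1 x) D).superRoot = (storeAll t c D).superRoot :=
        fun x => storeAll_congr fun u hu => Function.update_of_ne (by rintro rfl; exact he hu) _ _
      simp only [loadMoment, (hc _).1, (hc _).2, Function.update_self, he, not_false_eq_true,
        true_and]
      rw [expect_const_mul]
      split_ifs with hle
      · gcongr
        exact expect_fullAt_le i _ hle
      · simp

/-- The moment is at most `exp (s / 4)`, and `log 2 - 1 / 4 > 1 / 3`. -/
theorem load_tail {i : Fin (treeHeight n + 1)} {ν s : ℝ} (hs : 0 ≤ s) {D : List (U × V)}
    (hD : (keys D).card * (ν * 2 ^ (i : ℕ) / numBuckets n) ^ 2 ≤ s / 4) :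
    expect (PMF.uniformOfFintype (U → Bucket n × Bucket n)) (fun c =>
      if ((fullNodes i (storeAll t c D).server).card : ℝ) ≤ ν ∧
        s < (highCount (i + 1) (storeAll t c D).server (storeAll t c D).superRoot : ℝ)
      then 1 else 0) ≤ ENNReal.ofReal (Real.exp (-(s / 3))) := by
  set q := (ν * 2 ^ (i : ℕ) / numBuckets n) ^ 2 with hq
  have hq0 : 0 ≤ q := sq_nonneg _
  calc _ ≤ expect (PMF.uniformOfFintype (U → Bucket n × Bucket n)) (fun c =>
        loadMoment i ν (storeAll t c D) * ENNReal.ofReal (Real.exp (-(Real.log 2 * s)))) := by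
        refine expect_mono _ fun c _ => ?_
        unfold loadMoment
        by_cases h : ((fullNodes i (storeAll t c D).server).card : ℝ) ≤ ν
        · simp only [h, true_and, if_true]
          exact ite_lt_le_two_pow _ _
        · simp [h]
    _ ≤ (1 + ENNReal.ofReal q) ^ (keys D).card * ENNReal.ofReal (Real.exp (-(Real.log 2 * s))) := by
        rw [expect_mul_const]
        gcongr
        exact expect_loadMoment_le i ν D
    _ ≤ ENNReal.ofReal (Real.exp q) ^ (keys D).card *
          ENNReal.ofReal (Real.exp (-(Real.log 2 * s))) := by
        gcongr
        rw [← ENNReal.ofReal_one, ← ENNReal.ofReal_add zero_le_one hq0]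
        exact ENNReal.ofReal_le_ofReal (by linarith [Real.add_one_le_exp q])
    _ = ENNReal.ofReal (Real.exp ((keys D).card * q + -(Real.log 2 * s))) := by
        rw [← ENNReal.ofReal_pow (Real.exp_pos _).le, ← Real.exp_nat_mul,
          ← ENNReal.ofReal_mul (Real.exp_pos _).le, ← Real.exp_add]
    _ ≤ _ := by
        refine ENNReal.ofReal_le_ofReal (Real.exp_le_exp.2 ?_)
        have := Real.log_two_gt_d9
        nlinarith

/-- The threshold for the number of items of height at least `i`. -/
noncomputable def loadBound (n t i : ℕ) : ℝ :=
  n * ((t : ℝ) ^ 2 / 16) * (1 / 4) ^ i * (16 / (t : ℝ) ^ 2) ^ 2 ^ i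

theorem loadBound_nonneg (n t i : ℕ) : 0 ≤ loadBound n t i := by
  unfold loadBound
  positivity

theorem loadBound_zero (n : ℕ) {t : ℕ} (ht : 0 < t) : loadBound n t 0 = n := by
  have : (t : ℝ) ≠ 0 := Nat.cast_ne_zero.2 ht.ne'
  unfold loadBound
  simp
  field_simp

/-- The recursion behind the closed form: the left side bounds the expected number of keys that go
above height `i` when at most `loadBound n t i` items reach it. The factor 4 is the slack that
`load_tail` requires. -/
theorem loadBound_succ {n t : ℕ} (hn : 0 < n) (ht : 0 < t) (i : ℕ) :
    n * (loadBound n t i / t * 2 ^ i / n) ^ 2 = loadBound n t (i + 1) / 4 := by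
  have h1 : (t : ℝ) ≠ 0 := Nat.cast_ne_zero.2 ht.ne'
  have h2 : (n : ℝ) ≠ 0 := Nat.cast_ne_zero.2 hn.ne'
  have h3 : ((2 : ℝ) ^ i) ^ 2 * (1 / 4) ^ i = 1 := by
    rw [← pow_mul, mul_comm i 2, pow_mul, ← mul_pow]
    norm_num
  unfold loadBound
  rw [pow_succ 2 i, pow_mul, pow_succ (1 / 4 : ℝ) i]
  set x := (16 / (t : ℝ) ^ 2) ^ 2 ^ i
  set y := (1 / 4 : ℝ) ^ i
  set z := (2 : ℝ) ^ i
  calc (n : ℝ) * (n * ((t : ℝ) ^ 2 / 16) * y * x / t * z / n) ^ 2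
      = n * (t : ℝ) ^ 2 / 256 * x ^ 2 * y * (z ^ 2 * y) := by field_simp; ring
    _ = _ := by rw [h3]; ring

theorem le_numBuckets (n : ℕ) : n ≤ numBuckets n := by
  unfold numBuckets treeCount
  have h : 0 < 2 ^ treeHeight n := by positivity
  have h1 := Nat.div_add_mod (n + (2 ^ treeHeight n - 1)) (2 ^ treeHeight n)
  have h2 := Nat.mod_lt (n + (2 ^ treeHeight n - 1)) h
  rw [mul_comm] at h1
  omega

/-- The tail of the size of the super root. -/
theorem superRoot_tail (ht : 0 < t) {φ : ℝ} (hφ : 0 ≤ φ)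
    (hφ' : loadBound n t (treeHeight n) ≤ 3 * φ) {D : List (U × V)} (hD : (keys D).card ≤ n) :
    expect (PMF.uniformOfFintype (U → Bucket n × Bucket n))
      ({c | 3 * φ < ((storeAll t c D).superRoot.length : ℝ)}.indicator 1) ≤
      treeHeight n * ENNReal.ofReal (Real.exp (-φ)) := by
  have hn : 0 < n := Nat.pos_of_ne_zero (NeZero.ne n)
  have ht' : (0 : ℝ) < t := Nat.cast_pos.2 ht
  -- Level `i` is bad if few of its nodes are full and yet too many items lie above it. The cutoff
  -- `3 * φ` keeps the failure probability at `exp (-φ)` once `loadBound` is tiny.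
  set bad : Fin (treeHeight n) → (U → Bucket n × Bucket n) → Prop := fun i c =>
    ((fullNodes i.castSucc (storeAll t c D).server).card : ℝ) ≤ loadBound n t i / t ∧
      max (loadBound n t (i + 1)) (3 * φ) <
        (highCount (i + 1) (storeAll t c D).server (storeAll t c D).superRoot : ℝ) with hbad
  classical
  have hbadle : ∀ i, expect (PMF.uniformOfFintype (U → Bucket n × Bucket n))
      (fun c => if bad i c then 1 else 0) ≤ ENNReal.ofReal (Real.exp (-φ)) := by
    intro i
    refine le_trans (le_trans (le_of_eq ?_) (load_tail (t := t) (i := i.castSucc) (ν := loadBound n t i / t)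
      (s := max (loadBound n t (i + 1)) (3 * φ)) (D := D) (le_max_of_le_right (by positivity)) ?_))
      (ENNReal.ofReal_le_ofReal (Real.exp_le_exp.2 ?_))
    · refine expect_congr _ fun c _ => ?_
      simp only [hbad]
      congr 1
    · have hnb : (n : ℝ) ≤ numBuckets n := Nat.cast_le.2 (le_numBuckets n)
      have hn' : (0 : ℝ) < n := Nat.cast_pos.2 hn
      calc ((keys D).card : ℝ) * (loadBound n t i / t * 2 ^ (i : ℕ) / numBuckets n) ^ 2
          ≤ n * (loadBound n t i / t * 2 ^ (i : ℕ) / n) ^ 2 := by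
            have := loadBound_nonneg n t i
            gcongr
        _ = loadBound n t (i + 1) / 4 := loadBound_succ hn ht i
        _ ≤ _ := by gcongr; exact le_max_left _ _
    · have := le_max_right (loadBound n t (i + 1)) (3 * φ)
      linarith
  calc _ ≤ expect (PMF.uniformOfFintype (U → Bucket n × Bucket n))
        (fun c => ∑ i, if bad i c then 1 else 0) := by
        refine expect_indicator_le _ _ _ fun c hc => ?_
        by_contra hlt
        have hno : ∀ i, ¬ bad i c := by
          intro i hi
          refine hlt ?_
          have := Finset.single_le_sum (f := fun i => if bad i c then (1 : ℝ≥0∞) else 0)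
            (fun _ _ => zero_le) (Finset.mem_univ i)
          simpa [hi] using this
        have main : ∀ j, j ≤ treeHeight n →
            (highCount j (storeAll t c D).server (storeAll t c D).superRoot : ℝ) ≤
              max (loadBound n t j) (3 * φ) := by
          intro j
          induction j with
          | zero =>
            intro _
            rw [loadBound_zero n ht]
            exact le_max_of_le_left (Nat.cast_le.2 ((highCount_zero_storeAll c D).trans hD))
          | succ j ih =>
            intro hj
            have ih := ih (by omega)
            -- Either the doubly exponential threshold holds and few nodes are full, or the count is
            -- already below `3 * φ` and cannot increase with the height.
            rcases le_max_iff.1 ih with h | h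
            · by_contra! hgt
              refine hno ⟨j, hj⟩ ⟨?_, hgt⟩
              rw [le_div_iff₀ ht', mul_comm]
              refine le_trans ?_ h
              have := mul_card_fullNodes_le (Fin.castSucc ⟨j, hj⟩) (storeAll t c D).server
                (storeAll t c D).superRoot
              exact_mod_cast this
            · refine le_max_of_le_right (le_trans ?_ h)
              exact Nat.cast_le.2 (highCount_anti (Nat.le_succ j) _ _)
        have h1 := main _ le_rfl
        rw [max_eq_right hφ'] at h1
        have h2 : (storeAll t c D).superRoot.length ≤
          highCount (treeHeight n) (storeAll t c D).server (storeAll t c D).superRoot :=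
          Nat.le_add_left _ _
        have h3 : ((storeAll t c D).superRoot.length : ℝ) ≤ 3 * φ := (Nat.cast_le.2 h2).trans h1
        exact absurd hc (not_lt.2 h3)
    _ = ∑ i, expect (PMF.uniformOfFintype (U → Bucket n × Bucket n))
          (fun c => if bad i c then 1 else 0) := expect_sum _ _ _
    _ ≤ ∑ _i : Fin (treeHeight n), ENNReal.ofReal (Real.exp (-φ)) :=
        Finset.sum_le_sum fun i _ => hbadle i
    _ = _ := by simp

end LoadTail

/-! ### Sizes -/

section Sizes

theorem two_pow_treeHeight_le {n : ℕ} (hn : 2 ≤ n) : 2 ^ treeHeight n ≤ 2 * Nat.clog 2 n := by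
  unfold treeHeight
  have h1 : 1 ≤ Nat.clog 2 n := Nat.clog_pos one_lt_two hn
  rcases h1.eq_or_lt with h | h
  · simp [← h]
  · have h2 := Nat.pow_pred_clog_lt_self one_lt_two h
    have h3 : 0 < Nat.clog 2 (Nat.clog 2 n) := Nat.clog_pos one_lt_two h
    obtain ⟨k, hk⟩ := Nat.exists_eq_add_of_lt h3
    rw [hk] at h2 ⊢
    rw [pow_succ]
    simp only [Nat.pred_succ] at h2
    omega

theorem clog_le_self (n : ℕ) : Nat.clog 2 n ≤ n :=
  Nat.clog_le_of_le_pow Nat.lt_two_pow_self.le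

theorem treeHeight_le_self (n : ℕ) : treeHeight n ≤ n :=
  (clog_le_self _).trans (clog_le_self n)

theorem numBuckets_le {n : ℕ} (hn : 2 ≤ n) : numBuckets n ≤ 3 * n := by
  have h1 := two_pow_treeHeight_le hn
  have h2 := clog_le_self n
  have h3 : numBuckets n ≤ n + (2 ^ treeHeight n - 1) := Nat.div_mul_le_self _ _
  omega

/-- The number of nodes halves with each level, so all levels together cost at most twice the
leaves, and there are at most `3 * n` leaves. -/
theorem card_addr_le {n : ℕ} (hn : 2 ≤ n) (t : ℕ) :
    (Fintype.card (Addr n t) : ℝ) ≤ 6 * t * n := by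
  have h1 : ∀ i : Fin (treeHeight n + 1),
      ((numBuckets n / 2 ^ (i : ℕ) : ℕ) : ℝ) ≤ numBuckets n * (1 / 2) ^ (i : ℕ) := by
    intro i
    refine Nat.cast_div_le.trans (le_of_eq ?_)
    rw [one_div, inv_pow, div_eq_mul_inv]
    push_cast
    rfl
  have h2 : (numBuckets n : ℝ) ≤ 3 * n := by exact_mod_cast numBuckets_le hn
  rw [Fintype.card_prod, Fintype.card_sigma, Fintype.card_fin]
  simp only [Fintype.card_fin]
  push_cast
  calc (∑ i : Fin (treeHeight n + 1), ((numBuckets n / 2 ^ (i : ℕ) : ℕ) : ℝ)) * t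
      ≤ (∑ i : Fin (treeHeight n + 1), numBuckets n * (1 / 2 : ℝ) ^ (i : ℕ)) * t := by
        gcongr with i
        exact h1 i
    _ = numBuckets n * (∑ i ∈ Finset.range (treeHeight n + 1), (1 / 2 : ℝ) ^ i) * t := by
        rw [← Finset.mul_sum, Fin.sum_univ_eq_sum_range fun i => (1 / 2 : ℝ) ^ i]
    _ ≤ (3 * n) * 2 * t := by
        gcongr
        exact sum_geometric_two_le _
    _ = _ := by ring

theorem clog_le_log {n : ℕ} (hn : 2 ≤ n) : (Nat.clog 2 n : ℝ) ≤ 3 * Real.log n := by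
  have h1 : 0 < Nat.clog 2 n := Nat.clog_pos one_lt_two hn
  have h2 := Nat.pow_pred_clog_lt_self one_lt_two (show 1 < n by omega)
  obtain ⟨k, hk⟩ := Nat.exists_eq_add_of_lt h1
  rw [hk] at h2 ⊢
  simp only [zero_add, Nat.pred_succ] at h2 ⊢
  have h3 : (2 : ℝ) ^ k ≤ n := by exact_mod_cast h2.le
  have h4 : k * Real.log 2 ≤ Real.log n := by
    rw [← Real.log_pow]
    exact Real.log_le_log (by positivity) h3
  have h5 : Real.log 2 ≤ Real.log n := Real.log_le_log two_pos (by exact_mod_cast hn)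
  have h6 := Real.log_two_gt_d9
  push_cast
  nlinarith

theorem treeHeight_le_log {n : ℕ} (hn : 2 ≤ n) (h : 1 ≤ Real.log (Real.log n)) :
    (treeHeight n : ℝ) + 1 ≤ 6 * Real.log (Real.log n) := by
  have h0 : 0 < Real.log n := Real.log_pos (by exact_mod_cast hn)
  have h1 : (2 : ℝ) ^ treeHeight n ≤ 6 * Real.log n := by
    have h2 : (2 : ℝ) ^ treeHeight n ≤ 2 * Nat.clog 2 n := by
      exact_mod_cast two_pow_treeHeight_le hn
    linarith [clog_le_log hn]
  have h3 : treeHeight n * Real.log 2 ≤ Real.log 6 + Real.log (Real.log n) := by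
    rw [← Real.log_pow, ← Real.log_mul (by norm_num) h0.ne']
    exact Real.log_le_log (by positivity) h1
  have h4 : Real.log 6 ≤ 3 * Real.log 2 := by
    rw [show (3 : ℝ) = ((3 : ℕ) : ℝ) by norm_num, ← Real.log_pow]
    exact Real.log_le_log (by norm_num) (by norm_num)
  have h5 := Real.log_two_gt_d9
  by_contra! hlt
  nlinarith

theorem card_pos (n t : ℕ) : Fintype.card (Pos n t) = (treeHeight n + 1) * t := by
  simp [Fintype.card_prod]

/-- For `t ≥ 8` the base is at most `1 / 4`, and `2 ^ h ≥ log₂ n`, so the power is at most `1 / n ^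
2`, which beats the prefactor `n`. -/
theorem loadBound_treeHeight_le {n t : ℕ} (ht : 8 ≤ t) (hn : 0 < n) :
    loadBound n t (treeHeight n) ≤ (t : ℝ) ^ 2 / 16 / n := by
  have ht' : (8 : ℝ) ≤ t := by exact_mod_cast ht
  have hn' : (0 : ℝ) < n := Nat.cast_pos.2 hn
  have hr : 16 / (t : ℝ) ^ 2 ≤ 1 / 4 := by
    rw [div_le_div_iff₀ (by positivity) (by norm_num)]
    nlinarith
  have h1 : (16 / (t : ℝ) ^ 2) ^ 2 ^ treeHeight n ≤ 1 / (n : ℝ) ^ 2 := by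
    have h2 : n ≤ 2 ^ Nat.clog 2 n := Nat.le_pow_clog one_lt_two n
    have h3 : Nat.clog 2 n ≤ 2 ^ treeHeight n := Nat.le_pow_clog one_lt_two _
    calc (16 / (t : ℝ) ^ 2) ^ 2 ^ treeHeight n ≤ (1 / 4) ^ 2 ^ treeHeight n := by gcongr
      _ ≤ (1 / 4) ^ Nat.clog 2 n := pow_le_pow_of_le_one (by norm_num) (by norm_num) h3
      _ = 1 / ((2 : ℝ) ^ Nat.clog 2 n) ^ 2 := by
          rw [← pow_mul, mul_comm, pow_mul, one_div_pow]
          norm_num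
      _ ≤ 1 / (n : ℝ) ^ 2 := by
          gcongr
          exact_mod_cast h2
  have h4 : (1 / 4 : ℝ) ^ treeHeight n ≤ 1 := pow_le_one₀ (by norm_num) (by norm_num)
  calc loadBound n t (treeHeight n) ≤ n * ((t : ℝ) ^ 2 / 16) * 1 * (1 / (n : ℝ) ^ 2) := by
        unfold loadBound
        gcongr
    _ = _ := by field_simp

end Sizes

/-! ### The privacy bound with explicit constants. -/

section Privacy

open scoped ENNReal

variable {n t : ℕ} {U V : Type} [NeZero n] [Fintype U] [DecidableEq U]

theorem ofFn_eq_append_cons {α : Type} {l : ℕ} (f : Fin l → α) (j : Fin l) :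
    List.ofFn f = (List.ofFn f).take j ++ f j :: (List.ofFn f).drop (j + 1) := by
  have h : (j : ℕ) < (List.ofFn f).length := by simp
  conv_lhs => rw [← List.take_append_drop j (List.ofFn f), List.drop_eq_getElem_cons h]
  simp

theorem exists_ofFn_eq {α : Type} {l : ℕ} {f g : Fin l → α} {j : Fin l}
    (h : ∀ j' ≠ j, f j' = g j') :
    ∃ pre post, List.ofFn f = pre ++ f j :: post ∧ List.ofFn g = pre ++ g j :: post := by
  refine ⟨_, _, ofFn_eq_append_cons f j, (ofFn_eq_append_cons g j).trans ?_⟩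
  congr 1
  · refine List.ext_getElem (by simp) fun k h1 h2 => ?_
    simp only [List.getElem_take, List.getElem_ofFn]
    refine (h _ fun h' => ?_).symm
    have : k < j := by simp at h1; omega
    simp [← h'] at this
  · congr 1
    refine List.ext_getElem (by simp) fun k h1 h2 => ?_
    simp only [List.getElem_drop, List.getElem_ofFn]
    refine (h _ fun h' => ?_).symm
    have := congrArg Fin.val h'
    simp only at this
    omega

/-- Only the key of the differing query matters: kind and record do not enter the view. The ratio of
probabilities is a fixed power of `n`. -/
theorem dpAccess_execute {C : ℕ} (hC : 1 ≤ C) (hn : 3 ≤ n) (D : List (U × V)) {ε : ℝ}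
    (hε : 108 * Real.log n ≤ ε) :
    DPAccess (fun Q : List (Query U V) => (execute n t C D Q).map Execution.view) ε 0 := by
  intro l Q₁ Q₂ hQ S
  rw [hammingDist, Finset.card_eq_one] at hQ
  obtain ⟨j, hj⟩ := hQ
  have hne : ∀ j' ≠ j, (Q₁ j').1 = (Q₂ j').1 := by
    intro j' hj'
    have : j' ∉ (Finset.univ.filter fun i => queryKind (Q₁ i) ≠ queryKind (Q₂ i)) := by
      rw [hj]
      simpa using hj'
    simp only [Finset.mem_filter, Finset.mem_univ, true_and, not_not] at this
    have h : (queryKind (Q₁ j')).1 = (queryKind (Q₂ j')).1 := by rw [this]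
    exact h
  obtain ⟨pre, post, h1, h2⟩ := exists_ofFn_eq (f := fun j => (Q₁ j).1) (g := fun j => (Q₂ j).1) hne
  have hmap : ∀ Q : Fin l → Query U V,
      (List.ofFn Q).map Prod.fst = List.ofFn fun j => (Q j).1 := fun Q => by
    rw [List.map_ofFn]
    rfl
  have hb0 := numBuckets_ne_zero (n := n)
  have hbt : (numBuckets n : ℝ≥0∞) ≠ ⊤ := ENNReal.natCast_ne_top _
  have hcancel := ENNReal.mul_inv_cancel hb0 hbt
  -- `M = b ^ 2` satisfies `M * (p / b) ≥ 1` because `p ≥ 1 / b` for `C ≥ 1`.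
  have key := expect_view_le (n := n) (t := t) (C := C) (M := (numBuckets n : ℝ≥0∞) ^ 2)
    (one_le_pow₀ one_le_numBuckets)
    (by rw [sq, mul_assoc, hcancel, mul_one]; exact one_le_numBuckets)
    (by
      calc (1 : ℝ≥0∞) = (numBuckets n : ℝ≥0∞) ^ 2 *
            ((numBuckets n : ℝ≥0∞)⁻¹ * (numBuckets n : ℝ≥0∞)⁻¹) := by
            rw [sq, mul_mul_mul_comm, hcancel, one_mul]
        _ ≤ _ := by
            gcongr
            exact le_stashProb hC)
    D ((hmap Q₁).trans h1) ((hmap Q₂).trans h2) (S.indicator 1)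
  -- With `b ≤ n ^ 2` and `8 ≤ n ^ 2` the ratio is at most `n ^ (4 * (2 + 24)) = n ^ 104`, rounded
  -- up to `n ^ 108`.
  have hL : (8 * ((numBuckets n : ℝ≥0∞) ^ 2) ^ 6) ^ 4 ≤ ENNReal.ofReal (Real.exp ε) := by
    have hnb : numBuckets n ≤ n ^ 2 := (numBuckets_le (by omega)).trans (by nlinarith)
    have h8 : 8 ≤ n ^ 2 := by nlinarith
    have hn0 : (0 : ℝ) < n := by positivity
    calc (8 * ((numBuckets n : ℝ≥0∞) ^ 2) ^ 6) ^ 4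
        = (((8 * (numBuckets n ^ 2) ^ 6) ^ 4 : ℕ) : ℝ≥0∞) := by push_cast; rfl
      _ ≤ (((n ^ 2 * ((n ^ 2) ^ 2) ^ 6) ^ 4 : ℕ) : ℝ≥0∞) := by gcongr
      _ = ((n ^ 104 : ℕ) : ℝ≥0∞) := by congr 1; ring
      _ ≤ ((n ^ 108 : ℕ) : ℝ≥0∞) := by
          refine Nat.cast_le.2 (Nat.pow_le_pow_right (by omega) (by norm_num))
      _ = ENNReal.ofReal (Real.exp (108 * Real.log n)) := by
          rw [← ENNReal.ofReal_natCast, show (108 : ℝ) = ((108 : ℕ) : ℝ) by norm_num,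
            Real.exp_nat_mul, Real.exp_log hn0, Nat.cast_pow]
      _ ≤ _ := ENNReal.ofReal_le_ofReal (Real.exp_le_exp.2 hε)
  have hfin : ∀ p : PMF (List (List (Transfer n t))), expect p (S.indicator 1) ≠ ⊤ := fun p =>
    ((expect_indicator_le_one p S).trans_lt ENNReal.one_lt_top).ne
  rw [prob_eq_expect, prob_eq_expect, add_zero, ← ENNReal.toReal_ofReal (Real.exp_pos ε).le,
    ← ENNReal.toReal_mul]
  refine ENNReal.toReal_mono (ENNReal.mul_ne_top ENNReal.ofReal_ne_top (hfin _)) (key.trans ?_)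
  gcongr

end Privacy

/-! ### Client storage over a whole execution. -/

section ClientStorage

open scoped ENNReal

variable {n t : ℕ} {U V : Type} [DecidableEq U]

theorem keys_subset_storedKeys (D : List (U × V)) {P Q : List (Query U V)} (h : P <+: Q) :
    keys (D ++ writes P) ⊆ storedKeys D Q := by
  intro u hu
  simp only [keys, List.mem_toFinset, List.map_append, List.mem_append] at hu
  simp only [storedKeys, Finset.mem_union, List.mem_toFinset]
  refine hu.imp_right fun hu => ?_
  obtain ⟨e, he, rfl⟩ := List.mem_map.1 hu
  obtain ⟨⟨u, op⟩, hq, hqe⟩ := List.mem_filterMap.1 he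
  cases op with
  | read => simp at hqe
  | write v =>
    simp only [Option.some.injEq] at hqe
    subst hqe
    exact List.mem_map.2 ⟨_, List.mem_filter.2 ⟨h.subset hq, rfl⟩, rfl⟩

variable [NeZero n] [Fintype U]

/-- A union bound over the prefixes of the query sequence; each of them stores only keys from
`storedKeys D Q`, hence at most `n` distinct ones. -/
theorem superRoot_prefix_tail (ht : 0 < t) {φ : ℝ} (hφ : 0 ≤ φ)
    (hφ' : loadBound n t (treeHeight n) ≤ 3 * φ) (D : List (U × V)) (Q : List (Query U V))
    (hQ : (storedKeys D Q).card ≤ n) :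
    expect (PMF.uniformOfFintype (U → Bucket n × Bucket n))
      (Set.indicator {c | ∃ P, P <+: Q ∧
        3 * φ < ((storeAll t c (D ++ writes P)).superRoot.length : ℝ)} 1) ≤
      (Q.length + 1) * (treeHeight n * ENNReal.ofReal (Real.exp (-φ))) := by
  set S : ℕ → Set (U → Bucket n × Bucket n) := fun k =>
    {c | 3 * φ < ((storeAll t c (D ++ writes (Q.take k))).superRoot.length : ℝ)} with hS
  calc _ ≤ expect (PMF.uniformOfFintype (U → Bucket n × Bucket n))
        (fun c => ∑ k ∈ Finset.range (Q.length + 1), (S k).indicator 1 c) := by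
        refine expect_indicator_le _ _ _ fun c hc => ?_
        obtain ⟨P, hP, hc⟩ := hc
        have hk : P.length ∈ Finset.range (Q.length + 1) :=
          Finset.mem_range.2 (Nat.lt_succ_of_le hP.length_le)
        refine le_trans (le_of_eq ?_) (Finset.single_le_sum
          (f := fun k => (S k).indicator (1 : (U → Bucket n × Bucket n) → ℝ≥0∞) c) (fun _ _ => zero_le) hk)
        rw [Set.indicator_of_mem, Pi.one_apply]
        simp only [hS, Set.mem_ofPred_eq, ← List.prefix_iff_eq_take.1 hP]
        exact hc
    _ = ∑ k ∈ Finset.range (Q.length + 1),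
          expect (PMF.uniformOfFintype (U → Bucket n × Bucket n)) ((S k).indicator 1) :=
        expect_sum _ _ _
    _ ≤ ∑ _k ∈ Finset.range (Q.length + 1),
          treeHeight n * ENNReal.ofReal (Real.exp (-φ)) :=
        Finset.sum_le_sum fun k _ => superRoot_tail ht hφ hφ'
          ((Finset.card_le_card (keys_subset_storedKeys D (List.take_prefix k Q))).trans hQ)
    _ = _ := by simp

/-- Thresholds of `4 * φ` stashed buckets and `3 * φ` items in the super root. The union bounds cost
`treeHeight n ≤ n` levels and at most `n ^ a` queries, whence the power `a + 1`. -/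
theorem clientStorage_tail (ht : 0 < t) {φ B : ℝ} {C a : ℕ} (hφ : 0 ≤ φ)
    (hφ' : loadBound n t (treeHeight n) ≤ 3 * φ) (hC : (C : ℝ) ≤ φ)
    (hB : 4 * φ * Fintype.card (Pos n t) + 3 * φ ≤ B) (D : List (U × V)) (Q : List (Query U V))
    (hlen : Q.length ≤ n ^ a) (hQ : (storedKeys D Q).card ≤ n) :
    prob (execute n t C D Q) {e | ∃ x ∈ e.clientSizes, B < (x : ℝ)} ≤
      7 * (n : ℝ) ^ (a + 1) * Real.exp (-φ) := by
  have hn : 0 < n := Nat.pos_of_ne_zero (NeZero.ne n)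
  have hna : 1 ≤ n ^ a := Nat.one_le_pow _ _ hn
  rw [prob_eq_expect]
  refine ENNReal.toReal_le_of_le_ofReal (by positivity) ?_
  calc _ ≤ _ := expect_clientSizes_le C hB D Q
    _ ≤ (Q.length + 1) * (treeHeight n * ENNReal.ofReal (Real.exp (-φ))) +
        (4 * Q.length + 1) * ENNReal.ofReal (Real.exp (-φ)) := by
        gcongr
        · exact superRoot_prefix_tail ht hφ hφ' D Q hQ
        · exact stashTail_le hφ hC
    _ = (((Q.length + 1) * treeHeight n + (4 * Q.length + 1) : ℕ) : ℝ≥0∞) *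
          ENNReal.ofReal (Real.exp (-φ)) := by push_cast; ring
    _ ≤ ((7 * n ^ (a + 1) : ℕ) : ℝ≥0∞) * ENNReal.ofReal (Real.exp (-φ)) := by
        gcongr
        have h1 := treeHeight_le_self n
        calc (Q.length + 1) * treeHeight n + (4 * Q.length + 1)
            ≤ (n ^ a + n ^ a) * n + (4 * n ^ a + n ^ a) * n := by
              refine Nat.add_le_add (Nat.mul_le_mul (by omega) h1) ?_
              exact (show _ ≤ 4 * n ^ a + n ^ a by omega).trans (Nat.le_mul_of_pos_right _ hn)
          _ = 7 * n ^ (a + 1) := by ring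
    _ = _ := by
        rw [ENNReal.ofReal_mul (by positivity), ← ENNReal.ofReal_natCast]
        push_cast
        rfl

theorem prob_le_one {α : Type} (p : PMF α) (S : Set α) : prob p S ≤ 1 := by
  rw [prob_eq_expect]
  exact ENNReal.toReal_le_of_le_ofReal zero_le_one
    (by simpa using expect_indicator_le_one p S)

/-- Eventually `Φ n ≥ (a + k + 2) * log n`, so multiplying by `n ^ k` still leaves at most `7 / n`.
The trivial bound 1 serves for `n < n₁`. -/
theorem superpolynomialDecay_of_isLittleO {Φ : ℕ → ℝ}
    (hΦ : (fun n : ℕ => Real.log n) =o[atTop] Φ) (h0 : ∀ᶠ n in atTop, 0 ≤ Φ n) (a n₁ : ℕ) :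
    SuperpolynomialDecay atTop (fun n : ℕ => (n : ℝ)) fun n =>
      if n < n₁ then 1 else 7 * (n : ℝ) ^ (a + 1) * Real.exp (-Φ n) := by
  intro k
  have hc : (0 : ℝ) < 1 / (a + 1 + k + 1 : ℕ) := by positivity
  have hlim : Tendsto (fun n : ℕ => 7 * (1 / (n : ℝ))) atTop (nhds 0) := by
    simpa using (tendsto_one_div_atTop_nhds_zero_nat (𝕜 := ℝ)).const_mul 7
  refine squeeze_zero' ?_ ?_ hlim
  · filter_upwards with n
    split_ifs <;> positivity
  · filter_upwards [hΦ.def hc, h0, eventually_ge_atTop n₁, eventually_ge_atTop 1]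
      with n h1 h2 h3 h4
    have hn : (0 : ℝ) < n := Nat.cast_pos.2 h4
    have h5 : ((a + 1 + k + 1 : ℕ) : ℝ) * Real.log n ≤ Φ n := by
      rw [Real.norm_of_nonneg (Real.log_natCast_nonneg n), Real.norm_of_nonneg h2, one_div,
        inv_mul_eq_div, le_div_iff₀ (by positivity)] at h1
      linarith
    rw [if_neg (not_lt.2 h3)]
    have h6 : Real.exp (-Φ n) ≤ 1 / (n : ℝ) ^ (a + 1 + k + 1) := by
      rw [Real.exp_neg, one_div]
      gcongr
      calc (n : ℝ) ^ (a + 1 + k + 1) = Real.exp ((a + 1 + k + 1 : ℕ) * Real.log n) := by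
            rw [Real.exp_nat_mul, Real.exp_log hn]
        _ ≤ _ := Real.exp_le_exp.2 h5
    calc (n : ℝ) ^ k * (7 * (n : ℝ) ^ (a + 1) * Real.exp (-Φ n))
        ≤ (n : ℝ) ^ k * (7 * (n : ℝ) ^ (a + 1) * (1 / (n : ℝ) ^ (a + 1 + k + 1))) := by gcongr
      _ = _ := by
        rw [pow_succ (n : ℝ) (a + 1 + k), pow_add (n : ℝ) (a + 1) k]
        field_simp

end ClientStorage

end DPKVS

/-! ### Assembling the bounds. -/

theorem mainTheorem2 (t : ℕ) (ht : 81 * Real.exp 1 < (t : ℝ)) :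
    ∃ K : ℝ, 0 < K ∧
      (∃ n₀ : ℕ, ∀ (n : ℕ) [NeZero n], n₀ ≤ n →
        -- server storage
        (Fintype.card (DPKVS.Addr n t) : ℝ) ≤ K * n ∧
        ∀ (C : ℕ), 1 ≤ C →
        ∀ (U V : Type) [Fintype U] [DecidableEq U] (D : List (U × V)),
          -- correctness and bandwidth
          (∀ (Q : List (DPKVS.Query U V)), ∀ e ∈ (DPKVS.execute n t C D Q).support,
            e.answers = DPKVS.idealAnswers Q (DPKVS.initialDict D) ∧
            ∀ T ∈ e.view, (T.length : ℝ) ≤ K * Real.log (Real.log n)) ∧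
          -- privacy
          DPKVS.DPAccess
            (fun Q : List (DPKVS.Query U V) =>
              (DPKVS.execute n t C D Q).map DPKVS.Execution.view)
            (K * Real.log n) 0) ∧
      -- client storage
      (∀ Φ : ℕ → ℝ, (fun n : ℕ => Real.log n) =o[atTop] Φ → (∀ᶠ n in atTop, 0 ≤ Φ n) →
        ∀ C : ℕ → ℕ, (∀ᶠ n in atTop, (C n : ℝ) ≤ Φ n) →
        ∀ a : ℕ, ∃ negl : ℕ → ℝ, SuperpolynomialDecay atTop (fun n : ℕ => (n : ℝ)) negl ∧
          ∀ (n : ℕ) [NeZero n] (U V : Type) [Fintype U] [DecidableEq U]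
            (D : List (U × V)) (Q : List (DPKVS.Query U V)),
            Q.length ≤ n ^ a → (DPKVS.storedKeys D Q).card ≤ n →
            DPKVS.prob (DPKVS.execute n t (C n) D Q)
              {e | ∃ x ∈ e.clientSizes, K * (Φ n * Real.log (Real.log n)) < (x : ℝ)} ≤ negl n) := by
  have ht8 : 8 ≤ t := by
    have h1 : (8 : ℝ) ≤ t := by linarith [Real.add_one_le_exp (1 : ℝ)]
    exact_mod_cast h1
  have ht1 : (8 : ℝ) ≤ t := by exact_mod_cast ht8
  have hloglog : ∀ᶠ n : ℕ in atTop, 1 ≤ Real.log (Real.log n) :=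
    ((Real.tendsto_log_atTop.comp Real.tendsto_log_atTop).comp
      tendsto_natCast_atTop_atTop).eventually_ge_atTop 1
  -- `108 * t` exceeds all constants needed: `6 * t` for the server, `12 * 6 * t` for the bandwidth,
  -- 108 for privacy, and `24 * t + 3` for the client.
  refine ⟨108 * t, by positivity, ?_, ?_⟩
  · obtain ⟨n₀, hn₀⟩ := eventually_atTop.1 (hloglog.and (eventually_ge_atTop 3))
    refine ⟨n₀, fun n _ hn => ?_⟩
    obtain ⟨hL, hn3⟩ := hn₀ n hn
    refine ⟨(DPKVS.card_addr_le (by omega) t).trans ?_, fun C hC U V _ _ D => ⟨fun Q e he => ?_, ?_⟩⟩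
    · gcongr
      norm_num
    · obtain ⟨h1, h2⟩ := DPKVS.execute_correct C D Q he
      refine ⟨h1, fun T hT => ?_⟩
      rw [h2 T hT]
      push_cast
      have := DPKVS.treeHeight_le_log (by omega) hL
      nlinarith
    · refine DPKVS.dpAccess_execute hC hn3 D ?_
      have := Real.log_natCast_nonneg n
      nlinarith
  · intro Φ hΦ h0 C hC a
    -- Together with `log n ≤ Φ n` this puts the constant `t ^ 2 / 16`, which bounds `loadBound` at
    -- the root height, below `3 * Φ n`.
    have hlog : ∀ᶠ n : ℕ in atTop, (t : ℝ) ^ 2 / 16 ≤ Real.log n :=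
      (Real.tendsto_log_atTop.comp tendsto_natCast_atTop_atTop).eventually_ge_atTop _
    obtain ⟨n₁, hn₁⟩ := eventually_atTop.1 (hloglog.and ((eventually_ge_atTop 3).and
      (h0.and (hC.and (hlog.and (hΦ.def one_pos))))))
    refine ⟨_, DPKVS.superpolynomialDecay_of_isLittleO hΦ h0 a n₁, fun n _ U V _ _ D Q hlen hQ => ?_⟩
    split_ifs with hn
    · exact DPKVS.prob_le_one _ _
    · obtain ⟨hL, hn3, hΦ0, hCn, hlogn, hΦn⟩ := hn₁ n (not_lt.1 hn)
      rw [Real.norm_of_nonneg (Real.log_natCast_nonneg n), Real.norm_of_nonneg hΦ0, one_mul] at hΦn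
      refine DPKVS.clientStorage_tail (by omega) hΦ0 ?_ hCn ?_ D Q hlen hQ
      · have h1 := DPKVS.loadBound_treeHeight_le ht8 (show 0 < n by omega)
        have h2 : (t : ℝ) ^ 2 / 16 / n ≤ (t : ℝ) ^ 2 / 16 :=
          div_le_self (by positivity) (by exact_mod_cast (show 1 ≤ n by omega))
        linarith
      · have h1 := DPKVS.treeHeight_le_log (by omega) hL
        rw [DPKVS.card_pos]
        push_cast
        have h2 : 4 * Φ n * (((DPKVS.treeHeight n : ℝ) + 1) * t) ≤
            4 * Φ n * ((6 * Real.log (Real.log n)) * t) := by gcongr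
        have h3 : 3 * Φ n * 1 ≤ 3 * Φ n * Real.log (Real.log n) := by gcongr
        have h4 : 0 ≤ Φ n * Real.log (Real.log n) := by positivity
        nlinarith
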